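/- Setting. Let $(X_i,D_i,\{Y_i(d)\}_{d})$, $i\ge 1$, be i.i.d., where $X$ is a covariate vector (more generally, a random element of a standard Borel space), $D\in\{d_1,\dots,d_Q\}$ is a treatment and $Y(d)$ are integrable real potential outcomes; the observed outcome is $Y_i=Y_i(D_i)$. Fix a level $d_q$, put $\mu(d_q)=\mathbb E[Y(d_q)]$, $\pi(d|X)=\mathbb P(D=d|X)$, $a(X,D)=\mathbb E[Y|X,D]$, and assume that $Y(d_q)$ and $I_{d_q}(D)=1\{D=d_q\}$ are conditionally independent given $X$ and that $\pi(d_q|X)>0$ almost surely. Postulate propensity score (PS) models $\pi^j(d|x;\alpha^j)$, $j\le J$, and outcome regression (OR) models $a^k(x,d;\beta^k)$, $k\le K$, measurable in $x$, with parameters in (pseudo)metric spaces. A PS model $\pi^j$ is correctly specified if for some $\alpha_0$, $\pi^j(d|X;\alpha_0)=\pi(d|X)$ a.s. for all $d$; an OR model $a^k$ is correctly specified if for some $\beta_0$, $a^k(X,D;\beta_0)=a(X,D)$ a.s. The parameters are estimated by any $\hat\alpha^j,\hat\beta^k$ (depending on $n$) that converge in probability to limits $\alpha^j_*,\beta^k_*$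 such that, whenever a model is correctly specified, it equals the true function (in the sense just stated) at its limit. Put $\hat\theta^j=\frac1n\sum_{i=1}^n\pi^j(d_q|X_i;\hat\alpha^j)$, $\hat\eta^k=\frac1n\sum_{i=1}^n a^k(X_i,d_q;\hat\beta^k)$, $\theta^j_*=\mathbb E\,\pi^j(d_q|X;\alpha^j_*)$, $\eta^k_*=\mathbb E\,a^k(X,d_q;\beta^k_*)$; let $\hat g_i\in\mathbb R^{J+K}$ have components $\pi^j(d_q|X_i;\hat\alpha^j)-\hat\theta^j$ and $a^k(X_i,d_q;\hat\beta^k)-\hat\eta^k$, and let $g(x)\in\mathbb R^{J+K}$ have components $\pi^j(d_q|x;\alpha^j_*)-\theta^j_*$ and $a^k(x,d_q;\beta^k_*)-\eta^k_*$. With $\mathcal M_q=\{i\le n:D_i=d_q\}$ and $m_q=|\mathcal M_q|$, let $$F_n(\rho)=-\frac1n\sum_{i\in\mathcal M_q}\log(1+\rho^T\hat g_i),\qquad \mathcal D_n=\{\rho: 1+\rho^T\hat g_i>0,\ i\in\mathcal M_q\},\qquad \hat\rho^{min}=\arg\min_{\rho\in\mathcal D_n}F_n(\rho)$$ (and $\hat\rho^{min}=0$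 for a sample where no minimiser exists), and let $$\hat\mu_{MR}(d_q)=\sum_{i\in\mathcal M_q}\hat w_iY_i,\qquad \hat w_i=\frac{1}{m_q}\frac{1}{1+(\hat\rho^{min})^T\hat g_i}\bigg/\bigg\{\frac1{m_q}\sum_{i'\in\mathcal M_q}\frac1{1+(\hat\rho^{min})^T\hat g_{i'}}\bigg\}.$$ Let $F(\rho)=-\mathbb E[I_{d_q}(D)\log(1+\rho^Tg(X))]$ on the open set $\mathcal D$ of all $\rho$ such that, for some $\varepsilon>0$, $1+\rho^Tg(X)\ge\varepsilon$ almost surely on $\{D=d_q\}$. Regularity. Each model at treatment level $d_q$ is, at its limiting parameter value, bounded over almost every $x$ and continuous in the parameter uniformly over almost every $x$; and $\rho^Tg(X)=0$ almost surely only for $\rho=0$. Theorem. (i) With probability tending to one, $\mathcal D_n$ is a bounded open convex polytope, $F_n$ is strictly convex on $\mathcal D_n$, and $F_n$ has exactly one minimiser $\hat\rho^{min}$ in $\mathcal D_n$, which solves the estimating equation $\sum_{i\in\mathcal M_q}\hat g_i/(1+\rho^T\hat g_i)=0$. (ii) Suppose that $\pi(d_q|X)\ge c$ a.s. for some $c>0$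 and that some PS model $\pi^j$ is correctly specified. Write $\hat\pi_i=\pi^j(d_q|X_i;\hat\alpha^j)$. Then with probability tending to one there is exactly one $\hat\lambda\in\mathbb R^{J+K}$ with $1+\hat\lambda^T\hat g_i/\hat\pi_i>0$ for $i\in\mathcal M_q$ and $$\sum_{i\in\mathcal M_q}\frac{\hat g_i/\hat\pi_i}{1+\hat\lambda^T\hat g_i/\hat\pi_i}=0,$$ and $\hat\rho^{min}=\hat\rho^\pi:=(\hat\lambda+e_j)/\hat\theta^j$, where $e_j$ is the unit vector of the $j$-th PS coordinate. Moreover $\hat\mu_{MR}(d_q)\to\mu(d_q)$ in probability. (iii) Suppose that $F$ attains its minimum over $\mathcal D$ at some $\rho_*\in\mathcal D$. Then $\hat\rho^{min}\to\rho_*$ in probability; and if some OR model $a^k$ is correctly specified, then $\hat\mu_{MR}(d_q)\to\mu(d_q)$ in probability. -/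

import Mathlib

open MeasureTheory ProbabilityTheory Filter Topology

noncomputable section

namespace MRobust

/-- A unit: covariates, treatment received, and the vector of all potential outcomes. -/
abbrev Record (X : Type*) (Q : ℕ) := X × Fin Q × (Fin Q → ℝ)

section Units

variable {X : Type*} {Q : ℕ}

/-- The covariates of a unit. -/
def cov (z : Record X Q) : X := z.1

/-- The treatment received by a unit. -/
def trt (z : Record X Q) : Fin Q := z.2.1

/-- The potential outcome of a unit under treatment `q`. -/
def pot (q : Fin Q) (z : Record X Q) : ℝ := z.2.2 q

/-- The observed outcome: the potential outcome under the treatment received. -/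
def obsY (z : Record X Q) : ℝ := pot (trt z) z

/-- The indicator of receiving treatment `q`. -/
def ind (q : Fin Q) (z : Record X Q) : ℝ := if trt z = q then 1 else 0

end Units

section Population

variable {X : Type*} [MeasurableSpace X] {Q : ℕ}

/-- The σ-algebra generated by the covariates. -/
abbrev sigmaCov (X : Type*) [MeasurableSpace X] (Q : ℕ) : MeasurableSpace (Record X Q) :=
  MeasurableSpace.comap (cov : Record X Q → X) inferInstance

/-- The σ-algebra generated by the covariates and the treatment. -/
abbrev sigmaCovTrt (X : Type*) [MeasurableSpace X] (Q : ℕ) : MeasurableSpace (Record X Q) :=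
  MeasurableSpace.comap (fun z : Record X Q => (cov z, trt z)) inferInstance

lemma sigmaCov_le (X : Type*) [MeasurableSpace X] (Q : ℕ) :
    sigmaCov X Q ≤ (inferInstance : MeasurableSpace (Record X Q)) :=
  Measurable.comap_le measurable_fst

/-- The average potential outcome `μ(q) = E[Y(q)]`. -/
def apo (ν : Measure (Record X Q)) (q : Fin Q) : ℝ := ∫ z, pot q z ∂ν

/-- The true (generalised) propensity score `π(q | X) = E[1{D = q} | X]`. -/
def propensity (ν : Measure (Record X Q)) (q : Fin Q) : Record X Q → ℝ :=
  ν[ind q | sigmaCov X Q]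

/-- The true outcome regression `a(X, D) = E[Y | X, D]`. -/
def outcomeReg (ν : Measure (Record X Q)) : Record X Q → ℝ :=
  ν[obsY | sigmaCovTrt X Q]

/-- `Y(q)` is conditionally independent of `1{D = q}` given the covariates. -/
def Unconfounded [StandardBorelSpace X] (ν : Measure (Record X Q)) [IsFiniteMeasure ν]
    (q : Fin Q) : Prop :=
  CondIndepFun (sigmaCov X Q) (sigmaCov_le X Q) (pot q) (ind q) ν

/-- A propensity score model is correct at the parameter value `α`: it is the true propensity
score of every treatment level. -/
def CorrectPSAt {A : Type*} (ν : Measure (Record X Q)) (m : X → Fin Q → A → ℝ) (α : A) : Prop :=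
  ∀ d : Fin Q, (fun z : Record X Q => m (cov z) d α) =ᵐ[ν] propensity ν d

/-- An outcome regression model is correct at the parameter value `β`. -/
def CorrectORAt {B : Type*} (ν : Measure (Record X Q)) (m : X → Fin Q → B → ℝ) (β : B) : Prop :=
  (fun z : Record X Q => m (cov z) (trt z) β) =ᵐ[ν] outcomeReg ν

/-- At treatment level `q`, the model `m` is bounded in the covariates at the parameter value `α`,
and continuous in the parameter there, uniformly in the covariates. -/
def RegularAt {A : Type*} [PseudoMetricSpace A] (ν : Measure (Record X Q))
    (m : X → Fin Q → A → ℝ) (q : Fin Q) (α : A) : Prop :=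
  (∃ C : ℝ, ∀ᵐ z ∂ν, |m (cov z) q α| ≤ C) ∧
  ∀ ε > 0, ∃ δ > 0, ∀ᵐ z ∂ν, ∀ α' : A, dist α' α < δ →
    |m (cov z) q α' - m (cov z) q α| ≤ ε

end Population

/-- All postulated models at treatment level `q`, as one vector-valued function of the covariates:
first the `J` propensity score models, then the `K` outcome regression models. -/
def modelVec {X : Type*} {Q J K : ℕ} {A : Fin J → Type*} {B : Fin K → Type*}
    (ps : ∀ j, X → Fin Q → A j → ℝ) (om : ∀ k, X → Fin Q → B k → ℝ) (q : Fin Q)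
    (α : ∀ j, A j) (β : ∀ k, B k) (x : X) : Fin J ⊕ Fin K → ℝ :=
  Sum.elim (fun j => ps j x q (α j)) (fun k => om k x q (β k))

section Sample

/-! The estimator computed from the first `n` units of the sample `z`. Here `h` is the vector of
fitted models as a function of the covariates. -/

variable {X : Type*} {Q : ℕ} {ι : Type*} [Fintype ι]

/-- The units among the first `n` that received treatment `q`. -/
def treated (q : Fin Q) (n : ℕ) (z : ℕ → Record X Q) : Finset ℕ :=
  (Finset.range n).filter (fun i => trt (z i) = q)

/-- The sample means of the fitted models (over all `n` units). -/
def meanVec (h : X → ι → ℝ) (n : ℕ) (z : ℕ → Record X Q) (l : ι) : ℝ :=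
  (n : ℝ)⁻¹ * ∑ i ∈ Finset.range n, h (cov (z i)) l

/-- The centred vector `ĝ_i`. -/
def gHat (h : X → ι → ℝ) (n : ℕ) (z : ℕ → Record X Q) (i : ℕ) (l : ι) : ℝ :=
  h (cov (z i)) l - meanVec h n z l

/-- `1 + ρᵀ ĝ_i`. -/
def lin (h : X → ι → ℝ) (n : ℕ) (z : ℕ → Record X Q) (ρ : ι → ℝ) (i : ℕ) : ℝ :=
  1 + ρ ⬝ᵥ gHat h n z i

/-- The open polytope `D_n`. -/
def polytope (h : X → ι → ℝ) (q : Fin Q) (n : ℕ) (z : ℕ → Record X Q) : Set (ι → ℝ) :=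
  {ρ | ∀ i ∈ treated q n z, 0 < lin h n z ρ i}

/-- The objective `F_n`. -/
def objective (h : X → ι → ℝ) (q : Fin Q) (n : ℕ) (z : ℕ → Record X Q) (ρ : ι → ℝ) : ℝ :=
  -((n : ℝ)⁻¹ * ∑ i ∈ treated q n z, Real.log (lin h n z ρ i))

/-- `ρ` minimises `F_n` over `D_n`. -/
def IsMinimiser (h : X → ι → ℝ) (q : Fin Q) (n : ℕ) (z : ℕ → Record X Q) (ρ : ι → ℝ) : Prop :=
  ρ ∈ polytope h q n z ∧ IsMinOn (objective h q n z) (polytope h q n z) ρ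

open Classical in
/-- The root `ρ̂` found by convex minimisation: a minimiser of `F_n` over `D_n`
(and `0` for a sample for which there is none). -/
def rhoMin (h : X → ι → ℝ) (q : Fin Q) (n : ℕ) (z : ℕ → Record X Q) : ι → ℝ :=
  if hex : ∃ ρ, IsMinimiser h q n z ρ then hex.choose else 0

/-- The estimating equation `∑_{i ∈ M_q} ĝ_i / (1 + ρᵀ ĝ_i) = 0`. -/
def SolvesEE (h : X → ι → ℝ) (q : Fin Q) (n : ℕ) (z : ℕ → Record X Q) (ρ : ι → ℝ) : Prop :=
  ∀ l, ∑ i ∈ treated q n z, gHat h n z i l / lin h n z ρ i = 0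

/-- The weight `ŵ_i` computed from `ρ`. -/
def weight (h : X → ι → ℝ) (q : Fin Q) (n : ℕ) (z : ℕ → Record X Q) (ρ : ι → ℝ) (i : ℕ) : ℝ :=
  (((treated q n z).card : ℝ)⁻¹ * (lin h n z ρ i)⁻¹) /
    (((treated q n z).card : ℝ)⁻¹ * ∑ i' ∈ treated q n z, (lin h n z ρ i')⁻¹)

/-- The estimator `∑_{i ∈ M_q} ŵ_i Y_i` with weights computed from the minimiser of `F_n`. -/
def muHat (h : X → ι → ℝ) (q : Fin Q) (n : ℕ) (z : ℕ → Record X Q) : ℝ :=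
  ∑ i ∈ treated q n z, weight h q n z (rhoMin h q n z) i * obsY (z i)

/-- `lam` is the empirical likelihood multiplier that belongs to the propensity score model with
index `l₀`: the probabilities `p̂_i = m_q⁻¹ / (1 + lamᵀ ĝ_i / π̂_i)` are positive, and
`∑_{i ∈ M_q} (ĝ_i / π̂_i) / (1 + lamᵀ ĝ_i / π̂_i) = 0`, where `π̂_i` is the fitted model `l₀` at
unit `i`. -/
def IsMultiplier (h : X → ι → ℝ) (q : Fin Q) (n : ℕ) (z : ℕ → Record X Q) (l₀ : ι)
    (lam : ι → ℝ) : Prop :=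
  (∀ i ∈ treated q n z, 0 < 1 + lam ⬝ᵥ gHat h n z i / h (cov (z i)) l₀) ∧
  ∀ l, ∑ i ∈ treated q n z,
    (gHat h n z i l / h (cov (z i)) l₀) / (1 + lam ⬝ᵥ gHat h n z i / h (cov (z i)) l₀) = 0

/-- The root `ρ̂^π` obtained from a multiplier `lam`: `(lam + 1) / θ̂` in coordinate `l₀` and
`lam / θ̂` in all others, where `θ̂` is the sample mean of the fitted model `l₀`. -/
def rhoPi [DecidableEq ι] (h : X → ι → ℝ) (n : ℕ) (z : ℕ → Record X Q) (l₀ : ι)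
    (lam : ι → ℝ) : ι → ℝ :=
  fun l => (lam l + if l = l₀ then 1 else 0) / meanVec h n z l₀

/-- What the convex minimisation has to deliver for a sample: a strictly convex problem over a
bounded open convex set, with exactly one minimiser, which is `rhoMin` and which solves the
estimating equation. -/
def WellPosed (h : X → ι → ℝ) (q : Fin Q) (n : ℕ) (z : ℕ → Record X Q) : Prop :=
  IsOpen (polytope h q n z) ∧ Convex ℝ (polytope h q n z) ∧
  Bornology.IsBounded (polytope h q n z) ∧
  StrictConvexOn ℝ (polytope h q n z) (objective h q n z) ∧
  IsMinimiser h q n z (rhoMin h q n z) ∧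
  (∀ ρ, IsMinimiser h q n z ρ → ρ = rhoMin h q n z) ∧
  SolvesEE h q n z (rhoMin h q n z)

end Sample

section Limit

variable {X : Type*} [MeasurableSpace X] {Q : ℕ} {ι : Type*} [Fintype ι]

/-- The limit `g(x)` of the vectors `ĝ`: the models at the limiting parameter values, centred at
their expectations. -/
def gLim (ν : Measure (Record X Q)) (h : X → ι → ℝ) (x : X) (l : ι) : ℝ :=
  h x l - ∫ z, h (cov z) l ∂ν

/-- No nontrivial linear combination of the components of `g(X)` vanishes almost surely. -/
def Nondegenerate (ν : Measure (Record X Q)) (h : X → ι → ℝ) : Prop :=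
  ∀ ρ : ι → ℝ, ρ ≠ 0 → ¬ ∀ᵐ z ∂ν, ρ ⬝ᵥ gLim ν h (cov z) = 0

/-- The limit of the polytopes `D_n`, an open set: `1 + ρᵀ g(x)` is positive at all possible
realisations of `X` given `D = q`, that is, positive on the closed support of the law of `g(X)`
given `D = q`; as `g(X)` is bounded, this means bounded away from `0` almost surely. -/
def limDomain (ν : Measure (Record X Q)) (h : X → ι → ℝ) (q : Fin Q) : Set (ι → ℝ) :=
  {ρ | ∃ ε > 0, ∀ᵐ z ∂ν, trt z = q → ε ≤ 1 + ρ ⬝ᵥ gLim ν h (cov z)}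

/-- The limit of the objectives, `F(ρ) = -E[1{D = q} log(1 + ρᵀ g(X))]`. -/
def limObjective (ν : Measure (Record X Q)) (h : X → ι → ℝ) (q : Fin Q) (ρ : ι → ℝ) : ℝ :=
  -∫ z, ind q z * Real.log (1 + ρ ⬝ᵥ gLim ν h (cov z)) ∂ν

end Limit

/-- The events `E n` hold with probability tending to one. -/
def WPTO {Ω : Type*} [MeasurableSpace Ω] (P : Measure Ω) (E : ℕ → Ω → Prop) : Prop :=
  Tendsto (fun n => P {ω | ¬ E n ω}) atTop (𝓝 0)

end MRobust

end

/-!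
The estimator is driven by the convex problem of minimising
`F_n(ρ) = -n⁻¹ ∑ log (1 + ρᵀ ĝ_i)` over the polytope `D_n`.

*Well-posedness.* The limit `g(X)` of the vectors `ĝ` is centred and nondegenerate, so `ρᵀ g(X)` is
negative with positive probability for every `ρ ≠ 0`, and by positivity so it is on `{D = q}`.
Compactness of the sphere gives a quantitative version (`BoundedModel.exists_surrounded`), which a
uniform law of large numbers transfers to the sample. For a fixed sample this condition
(`Surrounded`) bounds the polytope and makes the objective strictly convex; since the objective is
large near the boundary of the polytope, there is exactly one minimiser, and it solves the
estimating equation (`Surrounded.wellPosed`).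

*Multipliers.* With `π̂_i = θ̂ + ĝ_{i,j}`, the map `λ ↦ (λ + e_j) / θ̂` carries the multipliers of a
propensity score model to the minimisers of `F_n` (`isMultiplier_iff`).

*Convergence of the minimiser.* If the limiting objective `F` has a minimiser `ρ_*` in the open
limiting domain, then it is strictly larger on a small sphere around `ρ_*`; the objectives `F_n`
converge to `F` uniformly on the ball, so by convexity their minimisers lie in the ball
(`UniformlyClose.tendsto_rhoMin`). Then averages weighted by `1 / (1 + ρ̂ᵀ ĝ_i)` converge, and the
estimator converges to `E[1{D = q} Y / (1 + ρ_*ᵀ g)] / E[1{D = q} / (1 + ρ_*ᵀ g)]`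
(`UniformlyClose.tendsto_muHat`).

*Identification.* If the propensity score model `j` is correct, then `ρ_* = e_j / θ_*` is a
minimiser of `F`, and `1 + ρ_*ᵀ g = π / θ_*`, so the limit is an inverse probability weighted mean, equal to
`μ(q)`. If the outcome regression model `k` is correct, then the limit of the estimating equation,
`E[1{D = q} g_k / (1 + ρ_*ᵀ g)] = 0`, says that the weighted mean of `a(X, q)`, which is that of
`Y`, equals `E[a(X, q)] = μ(q)`.

The parameter estimates are not assumed measurable. All probabilistic statements are therefore
reduced to finitely many events of probability tending to one, for outer measure; laws of large
numbers are only applied to fixed measurable functions of the units.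
-/

namespace MRobust

/-! ### Events whose probability tends to one, and laws of large numbers -/

section Asymptotics

variable {Ω : Type*} [MeasurableSpace Ω] {P : Measure Ω}

lemma WPTO.mono {E F : ℕ → Ω → Prop} (hE : WPTO P E) (h : ∀ n ω, E n ω → F n ω) : WPTO P F :=
  tendsto_of_tendsto_of_tendsto_of_le_of_le tendsto_const_nhds hE (fun _ => zero_le)
    fun n => measure_mono fun ω (hω : ¬ F n ω) hEω => hω (h n ω hEω)

lemma WPTO.and {E F : ℕ → Ω → Prop} (hE : WPTO P E) (hF : WPTO P F) :
    WPTO P (fun n ω => E n ω ∧ F n ω) := by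
  have h := hE.add hF
  rw [add_zero] at h
  refine tendsto_of_tendsto_of_tendsto_of_le_of_le tendsto_const_nhds h (fun _ => zero_le)
    fun n => (measure_mono fun ω hω => ?_).trans (measure_union_le _ _)
  by_contra hc
  simp only [Set.mem_union, Set.mem_ofPred_eq, not_or, not_not] at hc
  exact hω hc

lemma WPTO.of_ae {p : Ω → Prop} (h : ∀ᵐ ω ∂P, p ω) : WPTO P (fun _ ω => p ω) := by
  have h0 : P {ω | ¬ p ω} = 0 := h
  simp only [WPTO, h0, tendsto_const_nhds]

lemma WPTO.forall_mem_finset {κ : Type*} (t : Finset κ) {E : κ → ℕ → Ω → Prop}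
    (h : ∀ k ∈ t, WPTO P (E k)) : WPTO P (fun n ω => ∀ k ∈ t, E k n ω) := by
  classical
  induction t using Finset.induction_on with
  | empty => exact (WPTO.of_ae (p := fun _ => True) (by simp)).mono (by simp)
  | insert a s _ ih =>
    refine ((h a (by simp)).and (ih fun k hk => h k (by simp [hk]))).mono fun n ω hω => ?_
    simpa using hω

lemma WPTO.forall_fintype {κ : Type*} [Fintype κ] {E : κ → ℕ → Ω → Prop}
    (h : ∀ k, WPTO P (E k)) : WPTO P (fun n ω => ∀ k, E k n ω) :=
  (WPTO.forall_mem_finset Finset.univ fun k _ => h k).mono fun _ _ h k => h k (by simp)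

lemma WPTO.exists [IsProbabilityMeasure P] {E : ℕ → Ω → Prop} (hE : WPTO P E) :
    ∃ n ω, E n ω := by
  by_contra! hc
  have : ∀ n, P {ω | ¬ E n ω} = 1 := fun n => by simp [hc n]
  simp only [WPTO, this] at hE
  exact one_ne_zero (tendsto_nhds_unique tendsto_const_nhds hE)

lemma tendstoInMeasure_const_iff_wpto {V : Type*} [PseudoMetricSpace V] {f : ℕ → Ω → V} {v : V} :
    TendstoInMeasure P f atTop (fun _ => v) ↔
      ∀ ε > 0, WPTO P (fun n ω => dist (f n ω) v < ε) := by
  simp only [tendstoInMeasure_iff_dist, WPTO, not_lt]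

lemma abs_inv_mul_sum_sub_le {n : ℕ} {s : Finset ℕ} (hs : s ⊆ Finset.range n) {a b : ℕ → ℝ}
    {c : ℝ} (hc : 0 ≤ c) (h : ∀ i ∈ s, |a i - b i| ≤ c) :
    |(n : ℝ)⁻¹ * ∑ i ∈ s, a i - (n : ℝ)⁻¹ * ∑ i ∈ s, b i| ≤ c := by
  rw [← mul_sub, ← Finset.sum_sub_distrib, abs_mul, abs_of_nonneg (by positivity)]
  have h1 : |∑ i ∈ s, (a i - b i)| ≤ n * c := by
    refine (Finset.abs_sum_le_sum_abs _ _).trans ((Finset.sum_le_sum h).trans ?_)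
    rw [Finset.sum_const, nsmul_eq_mul]
    have := Finset.card_le_card hs
    rw [Finset.card_range] at this
    gcongr
  rcases Nat.eq_zero_or_pos n with rfl | hn
  · simpa using hc
  · have hn' : (0 : ℝ) < n := by exact_mod_cast hn
    rwa [inv_mul_le_iff₀ hn']

end Asymptotics

/-- The average of `f` over the first `n` members of the sequence `z`. -/
noncomputable def empMean {E : Type*} (f : E → ℝ) (n : ℕ) (z : ℕ → E) : ℝ :=
  (n : ℝ)⁻¹ * ∑ i ∈ Finset.range n, f (z i)

lemma abs_empMean_sub_le {E : Type*} {f g : E → ℝ} {n : ℕ} {z : ℕ → E} {c : ℝ} (hc : 0 ≤ c)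
    (h : ∀ i, |f (z i) - g (z i)| ≤ c) : |empMean f n z - empMean g n z| ≤ c :=
  abs_inv_mul_sum_sub_le subset_rfl hc fun i _ => h i

section LLN

variable {Ω : Type*} [MeasurableSpace Ω] {P : Measure Ω} {E : Type*} [MeasurableSpace E]
  {ν : Measure E} {Z : ℕ → Ω → E}

/-- The sequence `Z` is i.i.d. with common law `ν`. -/
structure IsIIDSample (P : Measure Ω) (ν : Measure E) (Z : ℕ → Ω → E) : Prop where
  measurable : ∀ i, Measurable (Z i)
  law : ∀ i, P.map (Z i) = ν
  indep : iIndepFun Z P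

lemma IsIIDSample.wpto_of_ae (hZ : IsIIDSample P ν Z) {p : E → Prop} (hp : ∀ᵐ z ∂ν, p z) :
    WPTO P (fun _ ω => ∀ i, p (Z i ω)) := by
  refine WPTO.of_ae (ae_all_iff.2 fun i => ?_)
  rw [← hZ.law i] at hp
  exact ae_of_ae_map (hZ.measurable i).aemeasurable hp

lemma IsIIDSample.lln [IsProbabilityMeasure P] (hZ : IsIIDSample P ν Z) {f : E → ℝ}
    (hf : Measurable f) (hint : Integrable f ν) {η : ℝ} (hη : 0 < η) :
    WPTO P (fun n ω => |empMean f n (fun i => Z i ω) - ∫ z, f z ∂ν| ≤ η) := by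
  have hmp : ∀ i, MeasurePreserving (Z i) P ν := fun i => ⟨hZ.measurable i, hZ.law i⟩
  have hae := strong_law_ae (μ := P) (fun i => f ∘ Z i)
    ((hmp 0).integrable_comp_of_integrable hint)
    (fun i j hij => (hZ.indep.indepFun hij).comp hf hf)
    (fun i => ⟨(hf.comp (hZ.measurable i)).aemeasurable, (hf.comp (hZ.measurable 0)).aemeasurable,
      by rw [← Measure.map_map hf (hZ.measurable i), ← Measure.map_map hf (hZ.measurable 0),
        hZ.law, hZ.law]⟩)
  have hE : ∫ ω, (f ∘ Z 0) ω ∂P = ∫ z, f z ∂ν := by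
    rw [← hZ.law 0, integral_map (hZ.measurable 0).aemeasurable hf.aestronglyMeasurable]
    rfl
  rw [hE] at hae
  have hmeas : ∀ n : ℕ, AEStronglyMeasurable
      (fun ω => (n : ℝ)⁻¹ • ∑ i ∈ Finset.range n, (f ∘ Z i) ω) P := fun n => by
    have hfZ : ∀ i, Measurable (f ∘ Z i) := fun i => hf.comp (hZ.measurable i)
    have hsum : Measurable (fun ω => ∑ i ∈ Finset.range n, (f ∘ Z i) ω) :=
      Finset.measurable_fun_sum _ fun i _ => hfZ i
    exact (hsum.const_mul (n : ℝ)⁻¹).aestronglyMeasurable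
  have h := tendstoInMeasure_of_tendsto_ae hmeas hae
  exact (tendstoInMeasure_const_iff_wpto.1 h η hη).mono fun n ω h => h.le

/-- A uniform law of large numbers: a class of functions that is Lipschitz in a parameter from a
compact set is controlled by a finite net. -/
lemma IsIIDSample.uniform_lln [IsProbabilityMeasure P] [IsProbabilityMeasure ν]
    (hZ : IsIIDSample P ν Z) {V : Type*} [PseudoMetricSpace V] {K : Set V} (hK : IsCompact K)
    {f : V → E → ℝ} (hf : ∀ ρ ∈ K, Measurable (f ρ)) (hint : ∀ ρ ∈ K, Integrable (f ρ) ν)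
    {L : ℝ} (hL : 0 ≤ L)
    (hlip : ∀ᵐ z ∂ν, ∀ ρ ∈ K, ∀ σ ∈ K, |f ρ z - f σ z| ≤ L * dist ρ σ) {η : ℝ} (hη : 0 < η) :
    WPTO P (fun n ω => ∀ ρ ∈ K, |empMean (f ρ) n (fun i => Z i ω) - ∫ z, f ρ z ∂ν| ≤ η) := by
  set δ := η / (3 * (L + 1)) with hδ_def
  have hδ : 0 < δ := by positivity
  have hLδ : L * δ ≤ η / 3 := by
    rw [hδ_def, ← mul_div_assoc, div_le_div_iff₀ (by positivity) (by norm_num)]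
    nlinarith
  obtain ⟨t, htK, htfin, hcover⟩ := hK.finite_cover_balls hδ
  have hnet := WPTO.forall_mem_finset htfin.toFinset
    (E := fun σ n ω => |empMean (f σ) n (fun i => Z i ω) - ∫ z, f σ z ∂ν| ≤ η / 3) fun σ hσ =>
      hZ.lln (hf σ (htK (htfin.mem_toFinset.1 hσ))) (hint σ (htK (htfin.mem_toFinset.1 hσ)))
        (by positivity)
  refine (hnet.and (hZ.wpto_of_ae hlip)).mono fun n ω ⟨h1, h2⟩ ρ hρ => ?_
  obtain ⟨σ, hσt, hσ⟩ := Set.mem_iUnion₂.1 (hcover hρ)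
  have hσK := htK hσt
  have hdist : L * dist ρ σ ≤ η / 3 :=
    (mul_le_mul_of_nonneg_left (Metric.mem_ball.1 hσ).le hL).trans hLδ
  have h3 : |empMean (f ρ) n (fun i => Z i ω) - empMean (f σ) n (fun i => Z i ω)| ≤ η / 3 :=
    abs_empMean_sub_le (by positivity) fun i => (h2 i ρ hρ σ hσK).trans hdist
  have h4 : |∫ z, f ρ z ∂ν - ∫ z, f σ z ∂ν| ≤ η / 3 := by
    rw [← integral_sub (hint ρ hρ) (hint σ hσK)]
    have := norm_integral_le_of_norm_le_const (μ := ν) (f := fun z => f ρ z - f σ z) (C := η / 3)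
      (by filter_upwards [hlip] with z hz using (hz ρ hρ σ hσK).trans hdist)
    simpa using this
  have h5 := h1 σ (htfin.mem_toFinset.2 hσt)
  rw [abs_le] at *
  constructor <;> linarith

end LLN

/-! ### The convex problem of a fixed sample -/

section Deterministic

variable {ι : Type*} [Fintype ι]

lemma abs_dotProduct_le (ρ v : ι → ℝ) : |ρ ⬝ᵥ v| ≤ ‖ρ‖ * ∑ l, |v l| := by
  rw [dotProduct, Finset.mul_sum]
  refine (Finset.abs_sum_le_sum_abs _ _).trans (Finset.sum_le_sum fun l _ => ?_)
  rw [abs_mul]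
  exact mul_le_mul_of_nonneg_right (norm_le_pi_norm ρ l) (abs_nonneg _)

lemma abs_dotProduct_le_card {ρ v : ι → ℝ} {C : ℝ} (hv : ∀ l, |v l| ≤ C) :
    |ρ ⬝ᵥ v| ≤ Fintype.card ι * C * ‖ρ‖ := by
  refine (abs_dotProduct_le ρ v).trans ?_
  rw [mul_comm]
  refine mul_le_mul_of_nonneg_right ((Finset.sum_le_sum fun l _ => hv l).trans ?_) (norm_nonneg _)
  simp

lemma log_sub_log_le_div {a b : ℝ} (ha : 0 < a) (hb : 0 < b) :
    Real.log b - Real.log a ≤ (b - a) / a := by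
  have h := Real.log_le_sub_one_of_pos (div_pos hb ha)
  rw [Real.log_div hb.ne' ha.ne'] at h
  rwa [sub_div, div_self ha.ne']

lemma abs_log_sub_log_le_mul {a b ε : ℝ} (hε : 0 < ε) (ha : ε ≤ a) (hb : ε ≤ b) :
    |Real.log a - Real.log b| ≤ ε⁻¹ * |a - b| := by
  have key : ∀ x y : ℝ, ε ≤ x → ε ≤ y → Real.log x - Real.log y ≤ ε⁻¹ * |x - y| := by
    intro x y hx hy
    have hy0 := hε.trans_le hy
    refine (log_sub_log_le_div hy0 (hε.trans_le hx)).trans ?_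
    rw [div_eq_inv_mul]
    exact (mul_le_mul_of_nonneg_left (le_abs_self _) (by positivity)).trans
      (mul_le_mul_of_nonneg_right (inv_anti₀ hε hy) (abs_nonneg _))
  rw [abs_le]
  constructor
  · have := key b a hb ha
    rw [abs_sub_comm] at this
    linarith
  · exact key a b ha hb

lemma abs_inv_sub_inv_le {a b ε : ℝ} (hε : 0 < ε) (ha : ε ≤ a) (hb : ε ≤ b) :
    |a⁻¹ - b⁻¹| ≤ (ε * ε)⁻¹ * |a - b| := by
  have ha0 := hε.trans_le ha
  have hb0 := hε.trans_le hb
  rw [inv_sub_inv ha0.ne' hb0.ne', abs_div, abs_of_pos (mul_pos ha0 hb0), abs_sub_comm,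
    div_eq_inv_mul]
  gcongr

variable {X : Type*} {Q : ℕ} {h : X → ι → ℝ} {q : Fin Q} {n : ℕ} {z : ℕ → Record X Q}

lemma treated_subset (q : Fin Q) (n : ℕ) (z : ℕ → Record X Q) :
    treated q n z ⊆ Finset.range n := Finset.filter_subset _ _

lemma mem_treated {i : ℕ} : i ∈ treated q n z ↔ i < n ∧ trt (z i) = q := by
  simp [treated]

lemma inv_mul_sum_treated (q : Fin Q) (n : ℕ) (z : ℕ → Record X Q) (f : Record X Q → ℝ) :
    (n : ℝ)⁻¹ * ∑ i ∈ treated q n z, f (z i) = empMean (fun w => ind q w * f w) n z := by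
  simp only [treated, empMean, ind, ite_mul, one_mul, zero_mul, Finset.sum_filter]

lemma lin_zero (i : ℕ) : lin h n z 0 i = 1 := by simp [lin]

lemma lin_sub_lin (ρ σ : ι → ℝ) (i : ℕ) :
    lin h n z ρ i - lin h n z σ i = (ρ - σ) ⬝ᵥ gHat h n z i := by
  simp only [lin, sub_dotProduct]
  ring

lemma lin_combo {a b : ℝ} (hab : a + b = 1) (ρ σ : ι → ℝ) (i : ℕ) :
    lin h n z (a • ρ + b • σ) i = a * lin h n z ρ i + b * lin h n z σ i := by
  simp only [lin, add_dotProduct, smul_dotProduct, smul_eq_mul]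
  linear_combination (-1 : ℝ) * hab

lemma continuous_lin (i : ℕ) : Continuous fun ρ => lin h n z ρ i := by
  unfold lin dotProduct
  fun_prop

lemma isOpen_polytope : IsOpen (polytope h q n z) := by
  have : polytope h q n z = ⋂ i ∈ treated q n z, {ρ | 0 < lin h n z ρ i} := by
    ext ρ
    simp [polytope]
  rw [this]
  exact isOpen_biInter_finset fun i _ => isOpen_lt continuous_const (continuous_lin i)

lemma convex_polytope : Convex ℝ (polytope h q n z) := by
  intro ρ hρ σ hσ a b ha hb hab i hi
  rw [lin_combo hab]
  have h1 := hρ i hi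
  have h2 := hσ i hi
  rcases ha.eq_or_lt with rfl | ha'
  · obtain rfl : b = 1 := by linarith
    simpa using h2
  · positivity

lemma convexOn_objective : ConvexOn ℝ (polytope h q n z) (objective h q n z) := by
  refine ⟨convex_polytope, fun ρ hρ σ hσ a b ha hb hab => ?_⟩
  simp only [objective, smul_eq_mul]
  have hsum : a * ∑ i ∈ treated q n z, Real.log (lin h n z ρ i) +
      b * ∑ i ∈ treated q n z, Real.log (lin h n z σ i) ≤
      ∑ i ∈ treated q n z, Real.log (lin h n z (a • ρ + b • σ) i) := by
    rw [Finset.mul_sum, Finset.mul_sum, ← Finset.sum_add_distrib]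
    refine Finset.sum_le_sum fun i hi => ?_
    rw [lin_combo hab]
    exact strictConcaveOn_log_Ioi.concaveOn.2 (hρ i hi) (hσ i hi) ha hb hab
  have := mul_le_mul_of_nonneg_left hsum (show (0 : ℝ) ≤ (n : ℝ)⁻¹ by positivity)
  linarith

/-- The sample average of the negative part of `ρᵀ ĝ` over the treated units is at least `δ ‖ρ‖`.
This is a quantitative form of the geometric condition that `0` is an interior point of the
convex hull of the vectors `ĝ_i`. -/
def Surrounded (h : X → ι → ℝ) (q : Fin Q) (n : ℕ) (z : ℕ → Record X Q) (δ : ℝ) : Prop :=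
  ∀ ρ : ι → ℝ, δ * ‖ρ‖ ≤ (n : ℝ)⁻¹ * ∑ i ∈ treated q n z, max (-(ρ ⬝ᵥ gHat h n z i)) 0

variable {δ : ℝ}

lemma Surrounded.exists_neg (hs : Surrounded h q n z δ) (hδ : 0 < δ) {ρ : ι → ℝ} (hρ : ρ ≠ 0) :
    0 < (n : ℝ)⁻¹ ∧ ∃ i ∈ treated q n z, ρ ⬝ᵥ gHat h n z i < 0 := by
  have h1 := (mul_pos hδ (norm_pos_iff.2 hρ)).trans_le (hs ρ)
  have hn : (0 : ℝ) ≤ (n : ℝ)⁻¹ := by positivity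
  refine ⟨hn.lt_of_ne fun h0 => by simp [← h0] at h1, ?_⟩
  by_contra! hc
  rw [Finset.sum_eq_zero fun i hi => max_eq_right (neg_nonpos.2 (hc i hi)), mul_zero] at h1
  exact h1.false

lemma Surrounded.norm_le (hs : Surrounded h q n z δ) (hδ : 0 < δ) {ρ : ι → ℝ}
    (hρ : ρ ∈ polytope h q n z) : ‖ρ‖ ≤ δ⁻¹ := by
  rw [inv_eq_one_div, le_div_iff₀' hδ]
  refine (hs ρ).trans ?_
  have h1 : ∑ i ∈ treated q n z, max (-(ρ ⬝ᵥ gHat h n z i)) 0 ≤ n := by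
    refine (Finset.sum_le_card_nsmul _ _ 1 fun i hi => ?_).trans ?_
    · have := hρ i hi
      rw [lin] at this
      exact max_le (by linarith) zero_le_one
    · rw [nsmul_eq_mul, mul_one]
      have := Finset.card_le_card (treated_subset q n z)
      rw [Finset.card_range] at this
      exact_mod_cast this
  exact (mul_le_mul_of_nonneg_left h1 (by positivity)).trans (inv_mul_le_one)

lemma Surrounded.strictConvexOn (hs : Surrounded h q n z δ) (hδ : 0 < δ) :
    StrictConvexOn ℝ (polytope h q n z) (objective h q n z) := by
  refine ⟨convex_polytope, fun ρ hρ σ hσ hne a b ha hb hab => ?_⟩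
  obtain ⟨hn, j, hj, hjlt⟩ := hs.exists_neg hδ (sub_ne_zero.2 hne)
  rw [← lin_sub_lin] at hjlt
  simp only [objective, smul_eq_mul]
  have hsum : a * ∑ i ∈ treated q n z, Real.log (lin h n z ρ i) +
      b * ∑ i ∈ treated q n z, Real.log (lin h n z σ i) <
      ∑ i ∈ treated q n z, Real.log (lin h n z (a • ρ + b • σ) i) := by
    rw [Finset.mul_sum, Finset.mul_sum, ← Finset.sum_add_distrib]
    refine Finset.sum_lt_sum (fun i hi => ?_) ⟨j, hj, ?_⟩
    · rw [lin_combo hab]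
      exact strictConcaveOn_log_Ioi.concaveOn.2 (hρ i hi) (hσ i hi) ha.le hb.le hab
    · rw [lin_combo hab]
      exact strictConcaveOn_log_Ioi.2 (hρ j hj) (hσ j hj) (by linarith : _ < _).ne ha hb hab
  have := mul_lt_mul_of_pos_left hsum hn
  linarith

lemma Surrounded.exists_isMinimiser (hs : Surrounded h q n z δ) (hδ : 0 < δ) :
    ∃ ρ, IsMinimiser h q n z ρ := by
  set T := treated q n z
  -- `M ≥ 1` bounds all factors on the polytope, so the objective is nonnegative
  -- as soon as one factor drops below `M ^ (-#T)`
  set M : ℝ := 1 + δ⁻¹ * ∑ i ∈ T, ∑ l, |gHat h n z i l| with hM_def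
  have hsum0 : 0 ≤ ∑ i ∈ T, ∑ l, |gHat h n z i l| :=
    Finset.sum_nonneg fun i _ => Finset.sum_nonneg fun l _ => abs_nonneg _
  have hM : 1 ≤ M := by
    rw [hM_def]
    have : 0 ≤ δ⁻¹ * ∑ i ∈ T, ∑ l, |gHat h n z i l| := by positivity
    linarith
  have hlogM : 0 ≤ Real.log M := Real.log_nonneg hM
  have hle : ∀ ρ ∈ polytope h q n z, ∀ i ∈ T, lin h n z ρ i ≤ M := by
    intro ρ hρ i hi
    have h1 := (le_abs_self _).trans (abs_dotProduct_le ρ (gHat h n z i))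
    have h2 : ∑ l, |gHat h n z i l| ≤ ∑ i ∈ T, ∑ l, |gHat h n z i l| :=
      Finset.single_le_sum (f := fun i => ∑ l, |gHat h n z i l|)
        (fun i _ => Finset.sum_nonneg fun l _ => abs_nonneg _) hi
    have h3 := mul_le_mul (hs.norm_le hδ hρ) h2 (Finset.sum_nonneg fun l _ => abs_nonneg _)
      (by positivity)
    rw [lin, hM_def]
    linarith
  set ε : ℝ := Real.exp (-(T.card * Real.log M)) with hε_def
  have hε : 0 < ε := Real.exp_pos _
  have hε1 : ε ≤ 1 := by
    rw [hε_def, Real.exp_le_one_iff, neg_nonpos]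
    positivity
  set S : Set (ι → ℝ) := Metric.closedBall 0 δ⁻¹ ∩ ⋂ i ∈ T, {ρ | ε ≤ lin h n z ρ i} with hS_def
  have hmemS : ∀ ρ, ρ ∈ S ↔ ‖ρ‖ ≤ δ⁻¹ ∧ ∀ i ∈ T, ε ≤ lin h n z ρ i := by
    intro ρ
    simp [hS_def]
  have hScpt : IsCompact S := (isCompact_closedBall _ _).inter_right
    (isClosed_biInter fun i _ => isClosed_le continuous_const (continuous_lin i))
  have hSP : S ⊆ polytope h q n z := fun ρ hρ i hi => hε.trans_le (((hmemS ρ).1 hρ).2 i hi)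
  have h0S : (0 : ι → ℝ) ∈ S := (hmemS 0).2 ⟨by simpa using hδ.le, fun i _ => by rwa [lin_zero]⟩
  have hcont : ContinuousOn (objective h q n z) S := by
    refine (continuousOn_const.mul (continuousOn_finsetSum _ fun i hi => ?_)).neg
    exact (continuous_lin i).continuousOn.log fun ρ hρ => (hSP hρ i hi).ne'
  obtain ⟨ρ₀, hρ₀, hmin⟩ := hScpt.exists_isMinOn ⟨0, h0S⟩ hcont
  refine ⟨ρ₀, hSP hρ₀, fun ρ hρ => ?_⟩
  by_cases hρS : ρ ∈ S
  · exact hmin hρS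
  have h0 : objective h q n z 0 = 0 := by simp [objective, lin_zero]
  have h0le : objective h q n z ρ₀ ≤ objective h q n z 0 := hmin h0S
  refine h0le.trans ?_
  rw [h0]
  obtain ⟨j, hj, hjε⟩ : ∃ j ∈ T, lin h n z ρ j < ε := by
    by_contra! hc
    exact hρS ((hmemS ρ).2 ⟨hs.norm_le hδ hρ, hc⟩)
  have hsum : ∑ i ∈ T, Real.log (lin h n z ρ i) ≤ 0 := by
    rw [← Finset.add_sum_erase T _ hj]
    have h1 : Real.log (lin h n z ρ j) ≤ -(T.card * Real.log M) := by
      have := Real.log_le_log (hρ j hj) hjε.le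
      rwa [hε_def, Real.log_exp] at this
    have h2 : ∑ i ∈ T.erase j, Real.log (lin h n z ρ i) ≤ (T.erase j).card • Real.log M :=
      Finset.sum_le_card_nsmul _ _ _ fun i hi =>
        Real.log_le_log (hρ i (Finset.mem_of_mem_erase hi))
          (hle ρ hρ i (Finset.mem_of_mem_erase hi))
    rw [nsmul_eq_mul] at h2
    have h3 : ((T.erase j).card : ℝ) ≤ T.card := by
      exact_mod_cast Finset.card_le_card (Finset.erase_subset _ _)
    have h4 := mul_le_mul_of_nonneg_right h3 hlogM
    linarith
  rw [objective, neg_nonneg]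
  exact mul_nonpos_of_nonneg_of_nonpos (by positivity) hsum

/-- The first-order condition: the polytope is open, so all directional derivatives of the
objective vanish at a minimiser. -/
lemma IsMinimiser.solvesEE {ρ : ι → ℝ} (hρ : IsMinimiser h q n z ρ) : SolvesEE h q n z ρ := by
  classical
  intro l
  rcases Nat.eq_zero_or_pos n with rfl | hn
  · simp [treated]
  have hloc : IsLocalMin (objective h q n z) ρ := hρ.2.isLocalMin (isOpen_polytope.mem_nhds hρ.1)
  set γ : ℝ → ι → ℝ := fun t => ρ + t • Pi.single l 1 with hγ
  have hγ0 : γ 0 = ρ := by simp [hγ]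
  have hγc : ContinuousAt γ 0 := by
    rw [hγ]
    fun_prop
  have hloc' : IsLocalMin (objective h q n z ∘ γ) 0 := by
    rw [← hγ0] at hloc
    exact IsMinFilter.comp_tendsto hloc hγc
  have hlin : ∀ i t, lin h n z (γ t) i = lin h n z ρ i + t * gHat h n z i l := by
    intro i t
    simp [hγ, lin, add_dotProduct, smul_dotProduct, single_dotProduct]
    ring
  have hder : HasDerivAt (objective h q n z ∘ γ)
      (-((n : ℝ)⁻¹ * ∑ i ∈ treated q n z, gHat h n z i l / lin h n z ρ i)) 0 := by
    refine HasDerivAt.neg (HasDerivAt.const_mul _ (HasDerivAt.fun_sum fun i hi => ?_))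
    simp only [hlin]
    have h1 : HasDerivAt (fun t : ℝ => lin h n z ρ i + t * gHat h n z i l) (gHat h n z i l) 0 := by
      simpa using ((hasDerivAt_id (0 : ℝ)).mul_const (gHat h n z i l)).const_add (lin h n z ρ i)
    have h2 := h1.log (by simpa using (hρ.1 i hi).ne')
    simpa using h2
  have h0 := hloc'.hasDerivAt_eq_zero hder
  have hn' : (n : ℝ)⁻¹ ≠ 0 := by positivity
  simpa [hn'] using h0

/-- Conversely, by the tangent line of the logarithm, a root of the estimating equation in the
polytope is a minimiser. -/
lemma SolvesEE.isMinimiser {ρ : ι → ℝ} (hρ : SolvesEE h q n z ρ) (hmem : ρ ∈ polytope h q n z) :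
    IsMinimiser h q n z ρ := by
  refine ⟨hmem, fun σ hσ => ?_⟩
  simp only [Set.mem_ofPred_eq, objective]
  have hsum : ∑ i ∈ treated q n z, (Real.log (lin h n z σ i) - Real.log (lin h n z ρ i)) ≤ 0 := by
    calc ∑ i ∈ treated q n z, (Real.log (lin h n z σ i) - Real.log (lin h n z ρ i))
        ≤ ∑ i ∈ treated q n z, (lin h n z σ i - lin h n z ρ i) / lin h n z ρ i :=
          Finset.sum_le_sum fun i hi => log_sub_log_le_div (hmem i hi) (hσ i hi)
      _ = ∑ i ∈ treated q n z, ∑ l, (σ - ρ) l * (gHat h n z i l / lin h n z ρ i) := by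
          refine Finset.sum_congr rfl fun i _ => ?_
          rw [lin_sub_lin, dotProduct, Finset.sum_div]
          simp only [mul_div_assoc]
      _ = 0 := by
          rw [Finset.sum_comm]
          refine Finset.sum_eq_zero fun l _ => ?_
          rw [← Finset.mul_sum, hρ l, mul_zero]
  rw [Finset.sum_sub_distrib] at hsum
  have := mul_nonpos_of_nonneg_of_nonpos (show (0 : ℝ) ≤ (n : ℝ)⁻¹ by positivity) hsum
  rw [mul_sub] at this
  linarith

lemma Surrounded.wellPosed (hs : Surrounded h q n z δ) (hδ : 0 < δ) : WellPosed h q n z := by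
  have hex := hs.exists_isMinimiser hδ
  have hmin : IsMinimiser h q n z (rhoMin h q n z) := by
    rw [rhoMin, dif_pos hex]
    exact hex.choose_spec
  refine ⟨isOpen_polytope, convex_polytope, ?_, hs.strictConvexOn hδ, hmin, fun ρ hρ => ?_,
    hmin.solvesEE⟩
  · exact (Metric.isBounded_closedBall (x := (0 : ι → ℝ)) (r := δ⁻¹)).subset fun ρ hρ => by
      simpa using hs.norm_le hδ hρ
  · exact (hs.strictConvexOn hδ).eq_of_isMinOn hρ.2 hmin.2 hρ.1 hmin.1

/-- By convexity, if the objective on a sphere around `σ` exceeds its value at `σ`, then all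
minimisers lie in the ball. -/
lemma IsMinimiser.dist_lt {ρ σ : ι → ℝ} {r : ℝ} (hr : 0 < r) (hρ : IsMinimiser h q n z ρ)
    (hσ : σ ∈ polytope h q n z)
    (hsph : ∀ τ ∈ Metric.sphere σ r, objective h q n z σ < objective h q n z τ) :
    dist ρ σ < r := by
  by_contra! hc
  have hd : 0 < dist ρ σ := hr.trans_le hc
  set t := r / dist ρ σ
  have ht0 : 0 < t := div_pos hr hd
  have ht1 : t ≤ 1 := (div_le_one hd).2 hc
  have hτ : t • ρ + (1 - t) • σ ∈ Metric.sphere σ r := by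
    have : t • ρ + (1 - t) • σ - σ = t • (ρ - σ) := by module
    rw [mem_sphere_iff_norm, this, norm_smul, Real.norm_of_nonneg ht0.le, ← dist_eq_norm,
      div_mul_cancel₀ _ hd.ne']
  have h1 := hsph _ hτ
  have h2 := (convexOn_objective (h := h)).2 hρ.1 hσ ht0.le (sub_nonneg.2 ht1) (by ring)
  have h3 : objective h q n z ρ ≤ objective h q n z σ := hρ.2 hσ
  simp only [smul_eq_mul] at h2
  nlinarith

end Deterministic

/-! ### The multiplier of a propensity score model -/

section Multiplier

variable {ι : Type*} [Fintype ι] [DecidableEq ι] {X : Type*} {Q : ℕ} {h : X → ι → ℝ} {q : Fin Q}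
  {n : ℕ} {z : ℕ → Record X Q} {l₀ : ι}

/-- The factorisation behind the equality of the two roots: it follows from
`π̂_i = θ̂ + ĝ_{i, l₀}`. -/
lemma lin_rhoPi (hθ : 0 < meanVec h n z l₀) {i : ℕ} (hi : 0 < h (cov (z i)) l₀) (lam : ι → ℝ) :
    lin h n z (rhoPi h n z l₀ lam) i =
      h (cov (z i)) l₀ / meanVec h n z l₀ * (1 + lam ⬝ᵥ gHat h n z i / h (cov (z i)) l₀) := by
  have h1 : rhoPi h n z l₀ lam = (meanVec h n z l₀)⁻¹ • (lam + Pi.single l₀ 1) := by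
    ext l
    simp only [rhoPi, Pi.smul_apply, Pi.add_apply, Pi.single_apply, smul_eq_mul]
    ring
  rw [lin, h1, smul_dotProduct, add_dotProduct, single_dotProduct, one_mul, smul_eq_mul]
  have h2 : gHat h n z i l₀ = h (cov (z i)) l₀ - meanVec h n z l₀ := rfl
  rw [h2]
  field_simp
  ring

lemma isMultiplier_iff (hθ : 0 < meanVec h n z l₀)
    (hπ : ∀ i ∈ treated q n z, 0 < h (cov (z i)) l₀) (lam : ι → ℝ) :
    IsMultiplier h q n z l₀ lam ↔ IsMinimiser h q n z (rhoPi h n z l₀ lam) := by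
  have hpos : (∀ i ∈ treated q n z, 0 < 1 + lam ⬝ᵥ gHat h n z i / h (cov (z i)) l₀) ↔
      rhoPi h n z l₀ lam ∈ polytope h q n z := by
    refine forall₂_congr fun i hi => ?_
    rw [lin_rhoPi hθ (hπ i hi), mul_pos_iff_of_pos_left (div_pos (hπ i hi) hθ)]
  have hee : (∀ l, ∑ i ∈ treated q n z, (gHat h n z i l / h (cov (z i)) l₀) /
      (1 + lam ⬝ᵥ gHat h n z i / h (cov (z i)) l₀) = 0) ↔
      SolvesEE h q n z (rhoPi h n z l₀ lam) := by
    refine forall_congr' fun l => ?_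
    have : ∑ i ∈ treated q n z, gHat h n z i l / lin h n z (rhoPi h n z l₀ lam) i =
        meanVec h n z l₀ * ∑ i ∈ treated q n z, (gHat h n z i l / h (cov (z i)) l₀) /
          (1 + lam ⬝ᵥ gHat h n z i / h (cov (z i)) l₀) := by
      rw [Finset.mul_sum]
      refine Finset.sum_congr rfl fun i hi => ?_
      rw [lin_rhoPi hθ (hπ i hi), div_mul_eq_div_div, div_div_eq_mul_div]
      ring
    rw [this, mul_eq_zero, or_iff_right hθ.ne']
  rw [IsMultiplier, hpos, hee]
  exact ⟨fun ⟨h1, h2⟩ => h2.isMinimiser h1, fun h1 => ⟨h1.1, h1.solvesEE⟩⟩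

/-- The map `lam ↦ ρ̂^π` is an affine bijection that carries multipliers to minimisers. -/
lemma WellPosed.existsUnique_multiplier (hwp : WellPosed h q n z) (hθ : 0 < meanVec h n z l₀)
    (hπ : ∀ i ∈ treated q n z, 0 < h (cov (z i)) l₀) :
    ∃ lam, IsMultiplier h q n z l₀ lam ∧ (∀ lam', IsMultiplier h q n z l₀ lam' → lam' = lam) ∧
      rhoMin h q n z = rhoPi h n z l₀ lam := by
  obtain ⟨_, _, _, _, hmin, huniq, _⟩ := hwp
  set lam : ι → ℝ := meanVec h n z l₀ • rhoMin h q n z - Pi.single l₀ 1 with hlam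
  have hrho : rhoPi h n z l₀ lam = rhoMin h q n z := by
    ext l
    simp only [rhoPi, hlam, Pi.sub_apply, Pi.smul_apply, Pi.single_apply, smul_eq_mul]
    field_simp
    ring
  refine ⟨lam, (isMultiplier_iff hθ hπ lam).2 (hrho ▸ hmin), fun lam' h' => ?_, hrho.symm⟩
  have h1 := (huniq _ ((isMultiplier_iff hθ hπ lam').1 h')).trans hrho.symm
  ext l
  have h2 := congrFun h1 l
  simp only [rhoPi] at h2
  rw [div_left_inj' hθ.ne'] at h2
  linarith

end Multiplier

/-! ### Conditional expectations given the covariates -/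

section Units

variable {X : Type*} {Q : ℕ}

lemma ind_nonneg (q : Fin Q) (z : Record X Q) : 0 ≤ ind q z := by
  unfold ind
  split_ifs <;> simp

lemma ind_le_one (q : Fin Q) (z : Record X Q) : ind q z ≤ 1 := by
  unfold ind
  split_ifs <;> simp

lemma abs_ind_le (q : Fin Q) (z : Record X Q) : |ind q z| ≤ 1 := by
  rw [abs_of_nonneg (ind_nonneg q z)]
  exact ind_le_one q z

lemma ind_mul_obsY (q : Fin Q) (z : Record X Q) : ind q z * obsY z = ind q z * pot q z := by
  unfold ind obsY
  split_ifs with h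
  · rw [h]
  · simp

lemma obsY_eq_sum (z : Record X Q) : obsY z = ∑ d, ind d z * pot d z := by
  simp [ind, obsY]

end Units

section MeasurableUnits

variable {X : Type*} [MeasurableSpace X] {Q : ℕ}

lemma measurable_cov : Measurable (cov : Record X Q → X) := measurable_fst

lemma measurable_trt : Measurable (trt : Record X Q → Fin Q) := measurable_snd.fst

lemma measurable_pot (q : Fin Q) : Measurable (pot q : Record X Q → ℝ) :=
  (measurable_pi_apply q).comp measurable_snd.snd

lemma measurable_ind (q : Fin Q) : Measurable (ind q : Record X Q → ℝ) :=
  Measurable.ite (measurable_trt (measurableSet_singleton q)) measurable_const measurable_const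

lemma measurable_obsY : Measurable (obsY : Record X Q → ℝ) := by
  simp only [funext obsY_eq_sum]
  exact Finset.measurable_fun_sum _ fun d _ => (measurable_ind d).mul (measurable_pot d)

lemma integrable_ind_mul {ν : Measure (Record X Q)} {f : Record X Q → ℝ} (hf : Integrable f ν)
    (q : Fin Q) :
    Integrable (fun z => ind q z * f z) ν :=
  hf.bdd_mul (measurable_ind q).aestronglyMeasurable (ae_of_all _ (abs_ind_le q))

lemma integrable_obsY {ν : Measure (Record X Q)}
    (hY : ∀ d, Integrable (pot d) ν) : Integrable (obsY : Record X Q → ℝ) ν := by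
  simp only [funext obsY_eq_sum]
  exact integrable_finsetSum _ fun d _ => integrable_ind_mul (hY d) d

end MeasurableUnits

/-- If `W` integrates to zero over every event of `Y`, then `E[W | Y] = 0`, hence `E[W Y] = 0`. -/
lemma integral_mul_eq_zero_of_setIntegral_preimage {E : Type*} [MeasurableSpace E] {μ : Measure E}
    [IsFiniteMeasure μ] {W Y : E → ℝ} (hY : Measurable Y) (hW : Integrable W μ)
    (hWY : Integrable (W * Y) μ)
    (h : ∀ s, MeasurableSet s → ∫ z in Y ⁻¹' s, W z ∂μ = 0) : ∫ z, W z * Y z ∂μ = 0 := by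
  have hW0 : (0 : E → ℝ) =ᵐ[μ] μ[W | MeasurableSpace.comap Y inferInstance] := by
    refine ae_eq_condExp_of_forall_setIntegral_eq hY.comap_le hW
      (fun _ _ _ => (integrable_zero _ _ _).integrableOn) (fun S hS _ => ?_)
      stronglyMeasurable_zero.aestronglyMeasurable
    obtain ⟨s, hs, rfl⟩ := hS
    rw [h s hs]
    simp
  have hYm : StronglyMeasurable[MeasurableSpace.comap Y inferInstance] Y :=
    (comap_measurable Y).stronglyMeasurable
  have h1 := condExp_mul_of_stronglyMeasurable_right hYm hWY hW
  have h2 : ∫ z, (μ[W * Y | MeasurableSpace.comap Y inferInstance]) z ∂μ = 0 := by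
    refine (integral_congr_ae (g := 0) ?_).trans (by simp)
    filter_upwards [h1, hW0] with z hz1 hz2
    rw [hz1, Pi.mul_apply, ← hz2]
    simp
  rwa [integral_condExp hY.comap_le] at h2

/-- In the integral of `f` against a bounded `m`-measurable function, `f` may be replaced by its
conditional expectation given `m`. -/
lemma integral_mul_eq_integral_condExp_mul {E : Type*} {m mE : MeasurableSpace E} {μ : Measure E}
    [IsFiniteMeasure μ] (hm : m ≤ mE) {f w : E → ℝ} (hf : Integrable f μ)
    (hw : StronglyMeasurable[m] w) {C : ℝ} (hC : ∀ᵐ z ∂μ, |w z| ≤ C) :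
    ∫ z, f z * w z ∂μ = ∫ z, (μ[f | m]) z * w z ∂μ := by
  have hint : Integrable (f * w) μ := hf.mul_bdd (hw.mono hm).aestronglyMeasurable hC
  rw [← integral_condExp hm (f := fun z => f z * w z)]
  exact integral_congr_ae (condExp_mul_of_stronglyMeasurable_right hw hint hf)

section Population

variable {X : Type*} [MeasurableSpace X] {Q : ℕ} {ν : Measure (Record X Q)}
  [IsProbabilityMeasure ν] {q : Fin Q}

lemma integrable_ind (q : Fin Q) : Integrable (ind q) ν :=
  Integrable.of_bound (measurable_ind q).aestronglyMeasurable 1 (ae_of_all _ (abs_ind_le q))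

lemma sigmaCovTrt_le :
    sigmaCovTrt X Q ≤ (inferInstance : MeasurableSpace (Record X Q)) :=
  Measurable.comap_le (measurable_cov.prodMk measurable_trt)

lemma stronglyMeasurable_comp_cov {w : X → ℝ} (hw : Measurable w) :
    StronglyMeasurable[sigmaCov X Q] fun z : Record X Q => w (cov z) :=
  (hw.comp (comap_measurable cov)).stronglyMeasurable

lemma propensity_mem_Icc (q : Fin Q) : ∀ᵐ z ∂ν, 0 ≤ propensity ν q z ∧ propensity ν q z ≤ 1 := by
  have h0 : 0 ≤ᵐ[ν] propensity ν q := condExp_nonneg (ae_of_all _ (ind_nonneg q))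
  have h1 : propensity ν q ≤ᵐ[ν] ν[(fun _ : Record X Q => (1 : ℝ)) | sigmaCov X Q] :=
    condExp_mono (integrable_ind q) (integrable_const 1) (ae_of_all _ (ind_le_one q))
  rw [condExp_const (sigmaCov_le X Q)] at h1
  filter_upwards [h0, h1] with z hz0 hz1 using ⟨hz0, hz1⟩

lemma abs_propensity_le (q : Fin Q) : ∀ᵐ z ∂ν, ‖propensity ν q z‖ ≤ 1 := by
  filter_upwards [propensity_mem_Icc q] with z hz
  rw [Real.norm_of_nonneg hz.1]
  exact hz.2

lemma stronglyMeasurable_ind_mul_comp_cov (q : Fin Q) {w : X → ℝ} (hw : Measurable w) :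
    StronglyMeasurable[sigmaCovTrt X Q] fun z : Record X Q => ind q z * w (cov z) := by
  have : (fun z : Record X Q => ind q z * w (cov z)) =
      (fun p : X × Fin Q => (if p.2 = q then (1 : ℝ) else 0) * w p.1) ∘
        fun z => (cov z, trt z) := rfl
  rw [this]
  refine Measurable.stronglyMeasurable (Measurable.comp ?_ (comap_measurable _))
  exact (Measurable.ite (measurable_snd (measurableSet_singleton q)) measurable_const
    measurable_const).mul (hw.comp measurable_fst)

variable [StandardBorelSpace X]

/-- Unconfoundedness for an event of the potential outcome, with the indicator of treatment
replaced by the propensity score. -/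
lemma Unconfounded.setIntegral_ind (h : Unconfounded ν q) {B : Set (Record X Q)}
    (hB : MeasurableSet[sigmaCov X Q] B) {s : Set ℝ} (hs : MeasurableSet s) :
    ∫ z in pot q ⁻¹' s, B.indicator 1 z * ind q z ∂ν =
      ∫ z in pot q ⁻¹' s, B.indicator 1 z * propensity ν q z ∂ν := by
  set S : Set (Record X Q) := pot q ⁻¹' s
  have hS : MeasurableSet S := measurable_pot q hs
  have hB' : MeasurableSet B := sigmaCov_le X Q _ hB
  have hone : MeasurableSet ({1} : Set ℝ) := measurableSet_singleton 1
  have hind : (ind q ⁻¹' {1}).indicator (fun _ => (1 : ℝ)) = (ind q : Record X Q → ℝ) := by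
    ext z
    by_cases hz : trt z = q <;> simp [Set.indicator, ind, hz]
  have hci := (condIndepFun_iff_condExp_inter_preimage_eq_mul (measurable_pot q)
    (measurable_ind q)).1 h s {1} hs hone
  rw [hind] at hci
  have hSint : Integrable (S.indicator fun _ => (1 : ℝ)) ν := (integrable_const 1).indicator hS
  have hpull : ν[propensity ν q * S.indicator (fun _ => (1 : ℝ)) | sigmaCov X Q] =ᵐ[ν]
      propensity ν q * ν[S.indicator (fun _ => (1 : ℝ)) | sigmaCov X Q] :=
    condExp_stronglyMeasurable_mul_of_bound (sigmaCov_le X Q) stronglyMeasurable_condExp hSint 1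
      (abs_propensity_le q)
  have hpint : Integrable (propensity ν q * S.indicator fun _ => (1 : ℝ)) ν :=
    hSint.bdd_mul integrable_condExp.aestronglyMeasurable (abs_propensity_le q)
  have hSI : MeasurableSet (S ∩ ind q ⁻¹' {1}) := hS.inter (measurable_ind q hone)
  have hswap : ∀ f : Record X Q → ℝ,
      ∫ z in S, B.indicator 1 z * f z ∂ν = ∫ z in B, f z * S.indicator (fun _ => 1) z ∂ν := by
    intro f
    rw [← integral_indicator hS, ← integral_indicator hB']
    congr 1
    ext z
    by_cases h1 : z ∈ S <;> by_cases h2 : z ∈ B <;> simp [h1, h2]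
  rw [hswap, hswap]
  calc ∫ z in B, ind q z * S.indicator (fun _ => 1) z ∂ν
      = ∫ z in B, (S ∩ ind q ⁻¹' {1}).indicator (fun _ => (1 : ℝ)) z ∂ν := by
        congr 1
        ext z
        rw [← hind]
        by_cases h1 : z ∈ S <;> by_cases h2 : z ∈ ind q ⁻¹' {1} <;>
          simp [Set.indicator, h1, h2]
    _ = ∫ z in B, (ν⟦S ∩ ind q ⁻¹' {1} | sigmaCov X Q⟧) z ∂ν :=
        (setIntegral_condExp (sigmaCov_le X Q) ((integrable_const 1).indicator hSI) hB).symm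
    _ = ∫ z in B, (ν[propensity ν q * S.indicator (fun _ => (1 : ℝ)) | sigmaCov X Q]) z ∂ν := by
        refine setIntegral_congr_ae hB' ?_
        filter_upwards [hci, hpull] with z h1 h2 _
        rw [h1, h2, Pi.mul_apply, mul_comm]
        rfl
    _ = ∫ z in B, propensity ν q z * S.indicator (fun _ => 1) z ∂ν :=
        setIntegral_condExp (sigmaCov_le X Q) hpint hB

/-- Under unconfoundedness, `E[1{D = q} Y(q) | X] = π(q | X) E[Y(q) | X]`. With
`W = 1_B (1{D = q} - π(q | X))` for an event `B` of the covariates, unconfoundedness says that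
`E[W | Y(q)] = 0`, hence `E[W Y(q)] = 0`. -/
lemma Unconfounded.condExp_ind_mul_pot (h : Unconfounded ν q) (hY : Integrable (pot q) ν) :
    ν[fun z => ind q z * pot q z | sigmaCov X Q] =ᵐ[ν]
      fun z => propensity ν q z * (ν[pot q | sigmaCov X Q]) z := by
  have hπY : Integrable (propensity ν q * pot q) ν :=
    hY.bdd_mul integrable_condExp.aestronglyMeasurable (abs_propensity_le q)
  have hIY : Integrable (fun z => ind q z * pot q z) ν := integrable_ind_mul hY q
  have hpull : ν[propensity ν q * pot q | sigmaCov X Q] =ᵐ[ν]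
      propensity ν q * ν[pot q | sigmaCov X Q] :=
    condExp_stronglyMeasurable_mul_of_bound (sigmaCov_le X Q) stronglyMeasurable_condExp hY 1
      (abs_propensity_le q)
  refine EventuallyEq.trans (EventuallyEq.symm ?_) hpull
  refine ae_eq_condExp_of_forall_setIntegral_eq (sigmaCov_le X Q) hIY
    (fun _ _ _ => integrable_condExp.integrableOn) (fun B hB _ => ?_)
    stronglyMeasurable_condExp.aestronglyMeasurable
  rw [setIntegral_condExp (sigmaCov_le X Q) hπY hB]
  have hB' : MeasurableSet B := sigmaCov_le X Q _ hB
  have hBind : StronglyMeasurable (B.indicator (1 : Record X Q → ℝ)) :=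
    stronglyMeasurable_one.indicator hB'
  have hBle : ∀ᵐ z ∂ν, ‖B.indicator (1 : Record X Q → ℝ) z‖ ≤ 1 := ae_of_all _ fun z => by
    by_cases hz : z ∈ B <;> simp [hz]
  have hW1 : Integrable (fun z => B.indicator 1 z * ind q z) ν :=
    (integrable_ind q).bdd_mul hBind.aestronglyMeasurable hBle
  have hW2 : Integrable (fun z => B.indicator 1 z * propensity ν q z) ν :=
    Integrable.bdd_mul integrable_condExp hBind.aestronglyMeasurable hBle
  set W : Record X Q → ℝ := fun z =>
    B.indicator 1 z * ind q z - B.indicator 1 z * propensity ν q z with hW_def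
  have hW : Integrable W ν := hW1.sub hW2
  have hWY : Integrable (W * pot q) ν := by
    refine hY.bdd_mul (c := 2) hW.aestronglyMeasurable ?_
    filter_upwards [abs_propensity_le (ν := ν) q, hBle] with z h1 h2
    have h3 : ‖ind q z‖ ≤ 1 := abs_ind_le q z
    rw [hW_def]
    refine (norm_sub_le _ _).trans ?_
    rw [norm_mul, norm_mul]
    have := norm_nonneg (B.indicator (1 : Record X Q → ℝ) z)
    nlinarith
  have hzero : ∫ z, W z * pot q z ∂ν = 0 :=
    integral_mul_eq_zero_of_setIntegral_preimage (measurable_pot q) hW hWY fun s hs => by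
      rw [hW_def, integral_sub hW1.integrableOn hW2.integrableOn, h.setIntegral_ind hB hs, sub_self]
  have hdiff : ∫ z in B, (propensity ν q * pot q : Record X Q → ℝ) z ∂ν -
      ∫ z in B, ind q z * pot q z ∂ν = 0 := by
    rw [← integral_sub hπY.integrableOn hIY.integrableOn, ← integral_indicator hB', ← neg_eq_zero,
      ← integral_neg, ← hzero]
    congr 1
    ext z
    by_cases hz : z ∈ B
    · simp [hW_def, hz]
      ring
    · simp [hW_def, hz]
  linarith

/-- Inverse probability weighting: if `π(q | X) w(X) = c` almost surely, then
`E[1{D = q} Y(q) w(X)] = c E[Y(q)]`. -/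
lemma Unconfounded.integral_ind_mul_pot_mul (h : Unconfounded ν q) (hY : Integrable (pot q) ν)
    {w : X → ℝ} (hw : Measurable w) {C c : ℝ} (hC : ∀ᵐ z ∂ν, |w (cov z)| ≤ C)
    (hc : ∀ᵐ z ∂ν, propensity ν q z * w (cov z) = c) :
    ∫ z, ind q z * pot q z * w (cov z) ∂ν = c * apo ν q := by
  rw [integral_mul_eq_integral_condExp_mul (sigmaCov_le X Q) (integrable_ind_mul hY q)
      (stronglyMeasurable_comp_cov hw) hC, apo,
    ← integral_condExp (sigmaCov_le X Q) (f := pot q), ← integral_const_mul]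
  refine integral_congr_ae ?_
  filter_upwards [h.condExp_ind_mul_pot hY, hc] with z h1 h2
  rw [h1, ← h2]
  ring

/-- A bounded function of `X` which agrees with the outcome regression on `{D = q}` is a version of
`E[Y(q) | X]`: both have the same product with the positive function `π(q | X)`. -/
lemma Unconfounded.integral_eq_apo (h : Unconfounded ν q) (hY : ∀ d, Integrable (pot d) ν)
    (hpos : ∀ᵐ z ∂ν, 0 < propensity ν q z) {a : X → ℝ} (ha : Measurable a) {C : ℝ}
    (hC : ∀ᵐ z ∂ν, |a (cov z)| ≤ C)
    (hreg : ∀ᵐ z ∂ν, trt z = q → a (cov z) = outcomeReg ν z) :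
    ∫ z, a (cov z) ∂ν = apo ν q := by
  have hm1 : sigmaCov X Q ≤ sigmaCovTrt X Q := by
    rintro _ ⟨s, hs, rfl⟩
    exact ⟨Prod.fst ⁻¹' s, measurable_fst hs, rfl⟩
  have hindm : StronglyMeasurable[sigmaCovTrt X Q] (ind q : Record X Q → ℝ) := by
    simpa using stronglyMeasurable_ind_mul_comp_cov q (w := fun _ => 1) measurable_const
  have h1 : ν[ind q * obsY | sigmaCovTrt X Q] =ᵐ[ν] ind q * outcomeReg ν :=
    condExp_stronglyMeasurable_mul_of_bound sigmaCovTrt_le hindm (integrable_obsY hY) 1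
      (ae_of_all _ (abs_ind_le q))
  have h2 : ν[ind q * obsY | sigmaCovTrt X Q] =ᵐ[ν] fun z => ind q z * a (cov z) := by
    filter_upwards [h1, hreg] with z hz1 hz2
    rw [hz1, Pi.mul_apply]
    by_cases hz : trt z = q
    · rw [hz2 hz]
    · simp [ind, hz]
  have ham : StronglyMeasurable[sigmaCov X Q] fun z : Record X Q => a (cov z) :=
    stronglyMeasurable_comp_cov ha
  have hIa : Integrable (fun z => ind q z * a (cov z)) ν :=
    (integrable_ind q).mul_bdd (ham.mono (sigmaCov_le X Q)).aestronglyMeasurable hC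
  have h3 : ν[fun z => ind q z * a (cov z) | sigmaCov X Q] =ᵐ[ν]
      fun z => propensity ν q z * a (cov z) :=
    condExp_mul_of_stronglyMeasurable_right ham hIa (integrable_ind q)
  have h4 : ν[fun z => ind q z * a (cov z) | sigmaCov X Q] =ᵐ[ν]
      ν[fun z => ind q z * pot q z | sigmaCov X Q] := by
    have h5 : ν[ν[ind q * obsY | sigmaCovTrt X Q] | sigmaCov X Q] =ᵐ[ν]
        ν[ind q * obsY | sigmaCov X Q] := condExp_condExp_of_le hm1 sigmaCovTrt_le
    have h6 : (ind q * obsY : Record X Q → ℝ) = fun z => ind q z * pot q z :=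
      funext fun z => ind_mul_obsY q z
    rw [← h6]
    exact (condExp_congr_ae h2.symm).trans h5
  rw [apo, ← integral_condExp (sigmaCov_le X Q) (f := pot q)]
  refine integral_congr_ae ?_
  filter_upwards [h3, h4, h.condExp_ind_mul_pot (hY q), hpos] with z g1 g2 g3 g4
  have : propensity ν q z * a (cov z) = propensity ν q z * (ν[pot q | sigmaCov X Q]) z := by
    rw [← g1, g2, g3]
  exact mul_left_cancel₀ g4.ne' this

end Population

/-! ### The limiting convex problem -/

section BoundedModel

variable {X : Type*} [MeasurableSpace X] {Q : ℕ} {ν : Measure (Record X Q)} {ι : Type*}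
  {h : X → ι → ℝ} {C : ℝ}

/-- The models at their limiting parameter values are measurable and bounded by `C`. -/
structure BoundedModel (ν : Measure (Record X Q)) (h : X → ι → ℝ) (C : ℝ) : Prop where
  nonneg : 0 ≤ C
  measurable : ∀ l, Measurable fun x => h x l
  bounded : ∀ᵐ z ∂ν, ∀ l, |h (cov z) l| ≤ C

lemma BoundedModel.measurable_gLim (hb : BoundedModel ν h C) (l : ι) :
    Measurable fun x => gLim ν h x l := (hb.measurable l).sub_const _

variable [IsProbabilityMeasure ν]

lemma BoundedModel.integrable (hb : BoundedModel ν h C) (l : ι) :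
    Integrable (fun z => h (cov z) l) ν :=
  Integrable.of_bound ((hb.measurable l).comp measurable_cov).aestronglyMeasurable C
    (hb.bounded.mono fun _ hz => hz l)

lemma BoundedModel.abs_gLim_le (hb : BoundedModel ν h C) :
    ∀ᵐ z ∂ν, ∀ l, |gLim ν h (cov z) l| ≤ 2 * C := by
  filter_upwards [hb.bounded] with z hz l
  have h1 : |∫ z, h (cov z) l ∂ν| ≤ C := by
    simpa using norm_integral_le_of_norm_le_const (μ := ν) (f := fun z => h (cov z) l) (C := C)
      (hb.bounded.mono fun _ hz => hz l)
  have h2 := (abs_sub (h (cov z) l) (∫ z, h (cov z) l ∂ν)).trans (add_le_add (hz l) h1)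
  rw [gLim]
  linarith

lemma BoundedModel.integrable_gLim (hb : BoundedModel ν h C) (l : ι) :
    Integrable (fun z => gLim ν h (cov z) l) ν := (hb.integrable l).sub (integrable_const _)

lemma BoundedModel.le_integral (hb : BoundedModel ν h C) {l₀ : ι} {c : ℝ}
    (hc : ∀ᵐ z ∂ν, c ≤ h (cov z) l₀) : c ≤ ∫ z, h (cov z) l₀ ∂ν := by
  have := integral_mono_ae (integrable_const c) (hb.integrable l₀) hc
  simpa using this

end BoundedModel

section LimitProblem

variable {X : Type*} [MeasurableSpace X] {Q : ℕ} {ν : Measure (Record X Q)} {ι : Type*} [Fintype ι]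
  {h : X → ι → ℝ} {q : Fin Q} {C : ℝ}

/-- `1 + ρᵀ g(x)`. -/
noncomputable def limLin (ν : Measure (Record X Q)) (h : X → ι → ℝ) (ρ : ι → ℝ) (x : X) : ℝ :=
  1 + ρ ⬝ᵥ gLim ν h x

lemma limLin_sub_limLin (ρ σ : ι → ℝ) (x : X) :
    limLin ν h ρ x - limLin ν h σ x = (ρ - σ) ⬝ᵥ gLim ν h x := by
  simp only [limLin, sub_dotProduct]
  ring

lemma BoundedModel.measurable_dotProduct (hb : BoundedModel ν h C) (ρ : ι → ℝ) :
    Measurable fun x => ρ ⬝ᵥ gLim ν h x :=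
  Finset.measurable_fun_sum _ fun l _ => (hb.measurable_gLim l).const_mul _

lemma BoundedModel.measurable_limLin (hb : BoundedModel ν h C) (ρ : ι → ℝ) :
    Measurable (limLin ν h ρ) := (hb.measurable_dotProduct ρ).const_add 1

/-- The inverse factor `1{D = q} / (1 + ρᵀ g(X))` of a parameter in the domain is bounded. -/
lemma abs_ind_mul_inv_limLin_le {ρ : ι → ℝ} {ε : ℝ} (hε : 0 < ε)
    (hρ : ∀ᵐ z ∂ν, trt z = q → ε ≤ limLin ν h ρ (cov z)) :
    ∀ᵐ z ∂ν, |ind q z * (limLin ν h ρ (cov z))⁻¹| ≤ ε⁻¹ := by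
  filter_upwards [hρ] with z hz
  by_cases hq : trt z = q
  · have h0 := hε.trans_le (hz hq)
    simp only [ind, if_pos hq, one_mul]
    rw [abs_of_pos (inv_pos.2 h0)]
    exact inv_anti₀ hε (hz hq)
  · simp only [ind, if_neg hq, zero_mul, abs_zero]
    positivity

lemma BoundedModel.measurable_ind_mul_inv (hb : BoundedModel ν h C) (q : Fin Q) (ρ : ι → ℝ) :
    Measurable fun z : Record X Q => ind q z * (limLin ν h ρ (cov z))⁻¹ :=
  (measurable_ind q).mul ((hb.measurable_limLin ρ).comp measurable_cov).inv

lemma BoundedModel.integrable_mul_ind_mul_inv (hb : BoundedModel ν h C) {ρ : ι → ℝ}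
    (hρ : ρ ∈ limDomain ν h q) {W : Record X Q → ℝ} (hW : Integrable W ν) :
    Integrable (fun z => W z * (ind q z * (limLin ν h ρ (cov z))⁻¹)) ν := by
  obtain ⟨ε, hε, hae⟩ := hρ
  exact hW.mul_bdd (hb.measurable_ind_mul_inv q ρ).aestronglyMeasurable
    (abs_ind_mul_inv_limLin_le hε hae)

variable [IsProbabilityMeasure ν]

lemma BoundedModel.abs_dotProduct_le (hb : BoundedModel ν h C) :
    ∀ᵐ z ∂ν, ∀ ρ : ι → ℝ, |ρ ⬝ᵥ gLim ν h (cov z)| ≤ Fintype.card ι * (2 * C) * ‖ρ‖ :=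
  hb.abs_gLim_le.mono fun _ hz _ => abs_dotProduct_le_card hz

lemma BoundedModel.integral_dotProduct (hb : BoundedModel ν h C) (ρ : ι → ℝ) :
    ∫ z, ρ ⬝ᵥ gLim ν h (cov z) ∂ν = 0 := by
  simp only [dotProduct]
  rw [integral_finsetSum _ fun l _ => (hb.integrable_gLim l).const_mul _]
  refine Finset.sum_eq_zero fun l _ => ?_
  rw [integral_const_mul]
  simp only [gLim]
  rw [integral_sub (hb.integrable l) (integrable_const _)]
  simp

lemma BoundedModel.integrable_dotProduct (hb : BoundedModel ν h C) (ρ : ι → ℝ) :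
    Integrable (fun z => ρ ⬝ᵥ gLim ν h (cov z)) ν :=
  integrable_finsetSum _ fun l _ => (hb.integrable_gLim l).const_mul _

/-- By positivity, a nonnegative function of the covariates that integrates to zero over
`{D = q}` vanishes almost surely. -/
lemma ae_eq_zero_of_integral_ind_mul (hpos : ∀ᵐ z ∂ν, 0 < propensity ν q z) {w : X → ℝ}
    (hw : Measurable w) (hw0 : ∀ x, 0 ≤ w x) {c : ℝ} (hc : ∀ᵐ z ∂ν, |w (cov z)| ≤ c)
    (h0 : ∫ z, ind q z * w (cov z) ∂ν ≤ 0) : ∀ᵐ z ∂ν, w (cov z) = 0 := by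
  have hwm := stronglyMeasurable_comp_cov (Q := Q) hw
  rw [integral_mul_eq_integral_condExp_mul (sigmaCov_le X Q) (integrable_ind q) hwm hc] at h0
  have hnn : 0 ≤ᵐ[ν] fun z => propensity ν q z * w (cov z) := by
    filter_upwards [hpos] with z hz using mul_nonneg hz.le (hw0 _)
  have hint : Integrable (fun z => propensity ν q z * w (cov z)) ν :=
    integrable_condExp.mul_bdd (hwm.mono (sigmaCov_le X Q)).aestronglyMeasurable hc
  have h1 := (integral_eq_zero_iff_of_nonneg_ae hnn hint).1
    (le_antisymm h0 (integral_nonneg_of_ae hnn))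
  filter_upwards [h1, hpos] with z hz1 hz2
  exact (mul_eq_zero.1 hz1).resolve_left hz2.ne'

/-- Since `g(X)` is centred and nondegenerate, `ρᵀ g(X)` is negative with positive probability on
`{D = q}` for all `ρ ≠ 0`; by compactness of the sphere this holds quantitatively. -/
lemma BoundedModel.exists_surrounded (hb : BoundedModel ν h C)
    (hpos : ∀ᵐ z ∂ν, 0 < propensity ν q z) (hnd : Nondegenerate ν h) :
    ∃ δ > 0, ∀ ρ ∈ Metric.sphere (0 : ι → ℝ) 1,
      δ ≤ ∫ z, ind q z * max (-(ρ ⬝ᵥ gLim ν h (cov z))) 0 ∂ν := by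
  have hm : ∀ ρ : ι → ℝ, Measurable fun x => max (-(ρ ⬝ᵥ gLim ν h x)) 0 := fun ρ =>
    (hb.measurable_dotProduct ρ).neg.max measurable_const
  have hint0 : ∀ ρ : ι → ℝ, Integrable (fun z => max (-(ρ ⬝ᵥ gLim ν h (cov z))) 0) ν := fun ρ =>
    (hb.integrable_dotProduct ρ).neg.sup (integrable_const 0)
  have hint := fun ρ => integrable_ind_mul (hint0 ρ) q
  set L : ℝ := Fintype.card ι * (2 * C) with hL
  have hlip : ∀ ρ σ : ι → ℝ, |∫ z, ind q z * max (-(ρ ⬝ᵥ gLim ν h (cov z))) 0 ∂ν -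
      ∫ z, ind q z * max (-(σ ⬝ᵥ gLim ν h (cov z))) 0 ∂ν| ≤ L * dist ρ σ := by
    intro ρ σ
    rw [← integral_sub (hint ρ) (hint σ)]
    have := norm_integral_le_of_norm_le_const (μ := ν) (C := L * dist ρ σ)
      (f := fun z => ind q z * max (-(ρ ⬝ᵥ gLim ν h (cov z))) 0 -
        ind q z * max (-(σ ⬝ᵥ gLim ν h (cov z))) 0) (by
      filter_upwards [hb.abs_dotProduct_le] with z hz
      rw [← mul_sub, norm_mul, dist_eq_norm]
      refine (mul_le_of_le_one_left (norm_nonneg _) (abs_ind_le q z)).trans ?_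
      refine (abs_max_sub_max_le_abs _ _ _).trans ?_
      rw [neg_sub_neg, ← sub_dotProduct, norm_sub_rev]
      exact hz _)
    simpa using this
  have hcont : Continuous fun ρ : ι → ℝ =>
      ∫ z, ind q z * max (-(ρ ⬝ᵥ gLim ν h (cov z))) 0 ∂ν := by
    have hL0 : 0 ≤ L := by
      have := hb.nonneg
      positivity
    refine (LipschitzWith.of_dist_le_mul (K := ⟨L, hL0⟩) fun ρ σ => ?_).continuous
    exact hlip ρ σ
  rcases (Metric.sphere (0 : ι → ℝ) 1).eq_empty_or_nonempty with he | hne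
  · exact ⟨1, one_pos, by simp [he]⟩
  obtain ⟨ρ₀, hρ₀, hmin⟩ := (isCompact_sphere (0 : ι → ℝ) 1).exists_isMinOn hne hcont.continuousOn
  refine ⟨_, ?_, fun ρ hρ => hmin hρ⟩
  by_contra! hle
  have hne0 : ρ₀ ≠ 0 := by
    rintro rfl
    simp at hρ₀
  have hz := ae_eq_zero_of_integral_ind_mul hpos (hm ρ₀) (fun _ => le_max_right _ _)
    (c := L * ‖ρ₀‖) (by
      filter_upwards [hb.abs_dotProduct_le] with z hz
      rw [abs_of_nonneg (le_max_right _ _)]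
      exact max_le ((neg_le_abs _).trans (hz ρ₀)) ((abs_nonneg _).trans (hz ρ₀))) hle
  have hnn : 0 ≤ᵐ[ν] fun z => ρ₀ ⬝ᵥ gLim ν h (cov z) := by
    filter_upwards [hz] with z hz
    have := le_max_left (-(ρ₀ ⬝ᵥ gLim ν h (cov z))) 0
    rw [hz] at this
    simpa using this
  exact hnd ρ₀ hne0 ((integral_eq_zero_iff_of_nonneg_ae hnn (hb.integrable_dotProduct ρ₀)).1
    (hb.integral_dotProduct ρ₀))

lemma BoundedModel.integrable_ind_mul_log (hb : BoundedModel ν h C) {ρ : ι → ℝ}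
    (hρ : ρ ∈ limDomain ν h q) :
    Integrable (fun z => ind q z * Real.log (limLin ν h ρ (cov z))) ν := by
  obtain ⟨ε, hε, hae⟩ := hρ
  have hm : Measurable fun z : Record X Q => ind q z * Real.log (limLin ν h ρ (cov z)) :=
    (measurable_ind q).mul (Real.measurable_log.comp ((hb.measurable_limLin ρ).comp measurable_cov))
  refine Integrable.of_bound hm.aestronglyMeasurable
    ((min ε 1)⁻¹ * (Fintype.card ι * (2 * C) * ‖ρ‖)) ?_
  filter_upwards [hae, hb.abs_dotProduct_le] with z h1 h2
  have hε' : 0 < min ε 1 := lt_min hε one_pos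
  by_cases hz : trt z = q
  · have h3 := abs_log_sub_log_le_mul hε' ((min_le_left _ _).trans (h1 hz)) (min_le_right ε 1)
    rw [Real.log_one, sub_zero, add_sub_cancel_left] at h3
    simp only [ind, if_pos hz, one_mul]
    exact h3.trans (mul_le_mul_of_nonneg_left (h2 ρ) (by positivity))
  · simp only [ind, if_neg hz, zero_mul, norm_zero]
    have := hb.nonneg
    positivity

/-- Strict midpoint convexity of the limiting objective: the logarithm is strictly concave, and
distinct parameters give distinct arguments with positive probability on `{D = q}`. -/
lemma BoundedModel.limObjective_midpoint_lt (hb : BoundedModel ν h C)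
    (hpos : ∀ᵐ z ∂ν, 0 < propensity ν q z) (hnd : Nondegenerate ν h) {ρ σ : ι → ℝ}
    (hρ : ρ ∈ limDomain ν h q) (hσ : σ ∈ limDomain ν h q) (hne : ρ ≠ σ) :
    (2 : ℝ)⁻¹ • ρ + (2 : ℝ)⁻¹ • σ ∈ limDomain ν h q ∧
    limObjective ν h q ((2 : ℝ)⁻¹ • ρ + (2 : ℝ)⁻¹ • σ) <
      2⁻¹ * limObjective ν h q ρ + 2⁻¹ * limObjective ν h q σ := by
  set τ := (2 : ℝ)⁻¹ • ρ + (2 : ℝ)⁻¹ • σ with hτ_def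
  have hlin : ∀ x, limLin ν h τ x = 2⁻¹ * limLin ν h ρ x + 2⁻¹ * limLin ν h σ x := by
    intro x
    simp only [limLin, hτ_def, add_dotProduct, smul_dotProduct, smul_eq_mul]
    ring
  have hτ : τ ∈ limDomain ν h q := by
    obtain ⟨ε₁, h1, h1'⟩ := hρ
    obtain ⟨ε₂, h2, h2'⟩ := hσ
    refine ⟨2⁻¹ * ε₁ + 2⁻¹ * ε₂, by positivity, ?_⟩
    filter_upwards [h1', h2'] with z g1 g2 hz
    change _ ≤ limLin ν h τ (cov z)
    rw [hlin]
    have := g1 hz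
    have := g2 hz
    simp only [limLin]
    linarith
  refine ⟨hτ, ?_⟩
  have iρ := hb.integrable_ind_mul_log hρ
  have iσ := hb.integrable_ind_mul_log hσ
  have iτ := hb.integrable_ind_mul_log hτ
  have hposlin : ∀ π ∈ limDomain ν h q, ∀ᵐ z ∂ν, trt z = q → 0 < limLin ν h π (cov z) := by
    rintro π ⟨ε, hε, hae⟩
    filter_upwards [hae] with z hz hq using hε.trans_le (hz hq)
  have hgap : 0 ≤ᵐ[ν] fun z => ind q z * Real.log (limLin ν h τ (cov z)) -
      (2⁻¹ * (ind q z * Real.log (limLin ν h ρ (cov z))) +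
        2⁻¹ * (ind q z * Real.log (limLin ν h σ (cov z)))) := by
    filter_upwards [hposlin ρ hρ, hposlin σ hσ] with z h1 h2
    by_cases hz : trt z = q
    · have := strictConcaveOn_log_Ioi.concaveOn.2 (h1 hz) (h2 hz)
        (show (0 : ℝ) ≤ 2⁻¹ by norm_num) (show (0 : ℝ) ≤ 2⁻¹ by norm_num) (by norm_num)
      simp only [smul_eq_mul, ← hlin] at this
      simp only [ind, if_pos hz, one_mul, Pi.zero_apply]
      linarith
    · simp [ind, hz]
  have hi2 : Integrable (fun z => 2⁻¹ * (ind q z * Real.log (limLin ν h ρ (cov z))) +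
      2⁻¹ * (ind q z * Real.log (limLin ν h σ (cov z)))) ν :=
    (iρ.const_mul 2⁻¹).add (iσ.const_mul 2⁻¹)
  have hval : ∫ z, (ind q z * Real.log (limLin ν h τ (cov z)) -
      (2⁻¹ * (ind q z * Real.log (limLin ν h ρ (cov z))) +
        2⁻¹ * (ind q z * Real.log (limLin ν h σ (cov z))))) ∂ν =
      2⁻¹ * limObjective ν h q ρ + 2⁻¹ * limObjective ν h q σ - limObjective ν h q τ := by
    rw [integral_sub iτ hi2, integral_add (iρ.const_mul _) (iσ.const_mul _), integral_const_mul,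
      integral_const_mul]
    simp only [limObjective, limLin]
    ring
  have hge := integral_nonneg_of_ae hgap
  rw [hval] at hge
  refine lt_of_le_of_ne (by linarith) fun heq => ?_
  have hzero := (integral_eq_zero_iff_of_nonneg_ae hgap (iτ.sub hi2)).1
    (by rw [hval, heq, sub_self])
  have habs : Measurable fun x => |(ρ - σ) ⬝ᵥ gLim ν h x| :=
    continuous_abs.measurable.comp (hb.measurable_dotProduct (ρ - σ))
  have hvanish := ae_eq_zero_of_integral_ind_mul hpos habs (fun _ => abs_nonneg _)
    (c := Fintype.card ι * (2 * C) * ‖ρ - σ‖)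
    (by
      filter_upwards [hb.abs_dotProduct_le] with z hz
      rw [abs_abs]
      exact hz _)
    (by
      refine (integral_congr_ae (g := 0) ?_).trans_le (by simp)
      filter_upwards [hzero, hposlin ρ hρ, hposlin σ hσ] with z h0 h1 h2
      by_cases hz : trt z = q
      · rw [← limLin_sub_limLin]
        have heq' : limLin ν h ρ (cov z) = limLin ν h σ (cov z) := by
          by_contra hne'
          have := strictConcaveOn_log_Ioi.2 (h1 hz) (h2 hz) hne'
            (show (0 : ℝ) < 2⁻¹ by norm_num) (show (0 : ℝ) < 2⁻¹ by norm_num) (by norm_num)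
          simp only [smul_eq_mul, ← hlin] at this
          simp only [ind, if_pos hz, one_mul, Pi.zero_apply] at h0
          linarith
        simp [heq']
      · simp [ind, hz])
  refine hnd (ρ - σ) (sub_ne_zero.2 hne) ?_
  filter_upwards [hvanish] with z hz using abs_eq_zero.1 hz

lemma BoundedModel.limObjective_lt (hb : BoundedModel ν h C)
    (hpos : ∀ᵐ z ∂ν, 0 < propensity ν q z) (hnd : Nondegenerate ν h) {ρ σ : ι → ℝ}
    (hρ : ρ ∈ limDomain ν h q) (hmin : IsMinOn (limObjective ν h q) (limDomain ν h q) ρ)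
    (hσ : σ ∈ limDomain ν h q) (hne : σ ≠ ρ) : limObjective ν h q ρ < limObjective ν h q σ := by
  obtain ⟨h1, h2⟩ := hb.limObjective_midpoint_lt hpos hnd hρ hσ hne.symm
  have h3 : limObjective ν h q ρ ≤ limObjective ν h q ((2 : ℝ)⁻¹ • ρ + (2 : ℝ)⁻¹ • σ) := hmin h1
  linarith

/-- On a small ball around a point of the domain, the arguments of the logarithm stay bounded away
from zero. -/
lemma BoundedModel.half_le_limLin (hb : BoundedModel ν h C) {ρ : ι → ℝ} {ε r : ℝ}
    (hρ : ∀ᵐ z ∂ν, trt z = q → ε ≤ limLin ν h ρ (cov z))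
    (hr : Fintype.card ι * (2 * C) * r ≤ ε / 2) :
    ∀ᵐ z ∂ν, trt z = q → ∀ σ ∈ Metric.closedBall ρ r, ε / 2 ≤ limLin ν h σ (cov z) := by
  filter_upwards [hρ, hb.abs_dotProduct_le] with z h1 h2 hz σ hσ
  have h3 := (abs_le.1 (h2 (σ - ρ))).1
  rw [← limLin_sub_limLin, ← dist_eq_norm] at h3
  have h4 : Fintype.card ι * (2 * C) * dist σ ρ ≤ Fintype.card ι * (2 * C) * r := by
    have := hb.nonneg
    exact mul_le_mul_of_nonneg_left hσ (by positivity)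
  linarith [h1 hz]

/-- The normalising constant `E[1{D = q} / (1 + ρᵀ g(X))]` is positive. -/
lemma BoundedModel.integral_ind_mul_inv_pos (hb : BoundedModel ν h C)
    (hpos : ∀ᵐ z ∂ν, 0 < propensity ν q z) {ρ : ι → ℝ} (hρ : ρ ∈ limDomain ν h q) :
    0 < ∫ z, 1 * (ind q z * (limLin ν h ρ (cov z))⁻¹) ∂ν := by
  have hint := hb.integrable_mul_ind_mul_inv hρ (integrable_const (μ := ν) (1 : ℝ))
  obtain ⟨ε, hε, hae⟩ := hρ
  have hnn : 0 ≤ᵐ[ν] fun z => 1 * (ind q z * (limLin ν h ρ (cov z))⁻¹) := by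
    filter_upwards [hae] with z hz
    by_cases hq : trt z = q
    · have : 0 < limLin ν h ρ (cov z) := hε.trans_le (hz hq)
      simp only [ind, if_pos hq, one_mul, Pi.zero_apply]
      positivity
    · simp [ind, hq]
  refine lt_of_le_of_ne (integral_nonneg_of_ae hnn) fun h0 => ?_
  have hzero := (integral_eq_zero_iff_of_nonneg_ae hnn hint).1 h0.symm
  have hone : ∀ᵐ z ∂ν, (1 : ℝ) = 0 :=
    ae_eq_zero_of_integral_ind_mul hpos (w := fun _ => 1) measurable_const (fun _ => zero_le_one)
      (c := 1) (by simp) (by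
        refine (integral_congr_ae (g := 0) ?_).trans_le (by simp)
        filter_upwards [hzero, hae] with z h1 h2
        by_cases hq : trt z = q
        · have : 0 < limLin ν h ρ (cov z) := hε.trans_le (h2 hq)
          simp [ind, hq, this.ne'] at h1
        · simp [ind, hq])
  obtain ⟨z, hz⟩ := hone.exists
  exact one_ne_zero hz

end LimitProblem

/-! ### Asymptotics of the minimiser and of the estimator -/

section FittedModels

variable {Ω : Type*} [MeasurableSpace Ω] {P : Measure Ω} [IsProbabilityMeasure P]
  {X : Type*} [MeasurableSpace X] {Q : ℕ} {ν : Measure (Record X Q)} [IsProbabilityMeasure ν]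
  {Z : ℕ → Ω → Record X Q} {ι : Type*} [Fintype ι] {hhat : ℕ → Ω → X → ι → ℝ} {h : X → ι → ℝ}
  {q : Fin Q} {C : ℝ}

/-- The fitted models `hhat` converge in probability to `h`, uniformly over the sample. -/
def UniformlyClose {Ω : Type*} [MeasurableSpace Ω] (P : Measure Ω) {X : Type*} {Q : ℕ}
    (Z : ℕ → Ω → Record X Q) {ι : Type*} (hhat : ℕ → Ω → X → ι → ℝ) (h : X → ι → ℝ) : Prop :=
  ∀ η > 0, WPTO P (fun n ω => ∀ i l, |hhat n ω (cov (Z i ω)) l - h (cov (Z i ω)) l| ≤ η)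

lemma UniformlyClose.wpto_meanVec (hZ : IsIIDSample P ν Z) (hb : BoundedModel ν h C)
    (hc : UniformlyClose P Z hhat h) {η : ℝ} (hη : 0 < η) :
    WPTO P (fun n ω => ∀ l,
      |meanVec (hhat n ω) n (fun i => Z i ω) l - ∫ z, h (cov z) l ∂ν| ≤ η) := by
  have hlln : WPTO P (fun n ω => ∀ l, |empMean (fun z : Record X Q => h (cov z) l) n
      (fun i => Z i ω) - ∫ z, h (cov z) l ∂ν| ≤ η / 2) :=
    WPTO.forall_fintype fun l =>
      hZ.lln ((hb.measurable l).comp measurable_cov) (hb.integrable l) (half_pos hη)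
  refine ((hc (η / 2) (half_pos hη)).and hlln).mono fun n ω ⟨h1, h2⟩ l => ?_
  have h3 : |meanVec (hhat n ω) n (fun i => Z i ω) l -
      empMean (fun z : Record X Q => h (cov z) l) n (fun i => Z i ω)| ≤ η / 2 :=
    abs_inv_mul_sum_sub_le subset_rfl (half_pos hη).le fun i _ => h1 i l
  have := abs_add_le (meanVec (hhat n ω) n (fun i => Z i ω) l -
      empMean (fun z : Record X Q => h (cov z) l) n (fun i => Z i ω))
      (empMean (fun z : Record X Q => h (cov z) l) n (fun i => Z i ω) - ∫ z, h (cov z) l ∂ν)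
  rw [sub_add_sub_cancel] at this
  linarith [h2 l]

lemma UniformlyClose.wpto_gHat (hZ : IsIIDSample P ν Z) (hb : BoundedModel ν h C)
    (hc : UniformlyClose P Z hhat h) {η : ℝ} (hη : 0 < η) :
    WPTO P (fun n ω => ∀ i l,
      |gHat (hhat n ω) n (fun i => Z i ω) i l - gLim ν h (cov (Z i ω)) l| ≤ η) := by
  refine ((hc (η / 2) (half_pos hη)).and (hc.wpto_meanVec hZ hb (half_pos hη))).mono
    fun n ω ⟨h1, h2⟩ i l => ?_
  rw [gHat, gLim, sub_sub_sub_comm]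
  refine (abs_sub _ _).trans ?_
  linarith [h1 i l, h2 l]

/-- The uniform law of large numbers on the unit sphere transfers the population bound to the
sample. -/
lemma UniformlyClose.exists_wpto_surrounded (hZ : IsIIDSample P ν Z) (hb : BoundedModel ν h C)
    (hc : UniformlyClose P Z hhat h) (hpos : ∀ᵐ z ∂ν, 0 < propensity ν q z)
    (hnd : Nondegenerate ν h) :
    ∃ δ > 0, WPTO P (fun n ω => Surrounded (hhat n ω) q n (fun i => Z i ω) δ) := by
  obtain ⟨δ, hδ, hδle⟩ := hb.exists_surrounded hpos hnd
  refine ⟨δ / 2, half_pos hδ, ?_⟩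
  set N : ℝ := (Fintype.card ι : ℝ)
  have hN : 0 ≤ N := Nat.cast_nonneg _
  set f : (ι → ℝ) → Record X Q → ℝ := fun ρ z =>
    ind q z * max (-(ρ ⬝ᵥ gLim ν h (cov z))) 0 with hf
  have hfm : ∀ ρ, Measurable (f ρ) := fun ρ => (measurable_ind q).mul
    (((hb.measurable_dotProduct ρ).comp measurable_cov).neg.max measurable_const)
  have hfi : ∀ ρ, Integrable (f ρ) ν := fun ρ =>
    integrable_ind_mul ((hb.integrable_dotProduct ρ).neg.sup (integrable_const 0)) q
  have hC := hb.nonneg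
  have hmax : ∀ a b : ℝ, |max (-a) 0 - max (-b) 0| ≤ |a - b| := fun a b => by
    refine (abs_max_sub_max_le_abs _ _ _).trans ?_
    rw [neg_sub_neg, abs_sub_comm]
  have hlip : ∀ᵐ z ∂ν, ∀ ρ ∈ Metric.sphere (0 : ι → ℝ) 1, ∀ σ ∈ Metric.sphere (0 : ι → ℝ) 1,
      |f ρ z - f σ z| ≤ N * (2 * C) * dist ρ σ := by
    filter_upwards [hb.abs_dotProduct_le] with z hz ρ _ σ _
    rw [hf, ← mul_sub, abs_mul, dist_eq_norm]
    refine (mul_le_of_le_one_left (abs_nonneg _) (abs_ind_le q z)).trans ((hmax _ _).trans ?_)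
    rw [← sub_dotProduct]
    exact hz _
  have hull := hZ.uniform_lln (isCompact_sphere (0 : ι → ℝ) 1) (fun ρ _ => hfm ρ)
    (fun ρ _ => hfi ρ) (by positivity) hlip (η := δ / 4) (by positivity)
  have hclose := hc.wpto_gHat hZ hb (η := δ / (4 * (N + 1))) (by positivity)
  refine (hull.and hclose).mono fun n ω ⟨h1, h2⟩ ρ => ?_
  have hsphere : ∀ u ∈ Metric.sphere (0 : ι → ℝ) 1, δ / 2 ≤ (n : ℝ)⁻¹ *
      ∑ i ∈ treated q n (fun i => Z i ω),
        max (-(u ⬝ᵥ gHat (hhat n ω) n (fun i => Z i ω) i)) 0 := by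
    intro u hu
    have hu1 : ‖u‖ = 1 := by simpa using hu
    have h3 : |(n : ℝ)⁻¹ * ∑ i ∈ treated q n (fun i => Z i ω),
          max (-(u ⬝ᵥ gHat (hhat n ω) n (fun i => Z i ω) i)) 0 -
        (n : ℝ)⁻¹ * ∑ i ∈ treated q n (fun i => Z i ω),
          max (-(u ⬝ᵥ gLim ν h (cov (Z i ω)))) 0| ≤ δ / 4 := by
      refine abs_inv_mul_sum_sub_le (treated_subset _ _ _) (by positivity) fun i _ => ?_
      refine (hmax _ _).trans ?_
      rw [← dotProduct_sub]
      refine (abs_dotProduct_le_card fun l => h2 i l).trans ?_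
      rw [hu1, mul_one, ← mul_div_assoc, div_le_div_iff₀ (by positivity) (by norm_num)]
      nlinarith
    rw [inv_mul_sum_treated q n (fun i => Z i ω)
      (fun z => max (-(u ⬝ᵥ gLim ν h (cov z))) 0)] at h3
    have h4 := (abs_le.1 (h1 u hu)).1
    have h5 := (abs_le.1 h3).1
    have h6 := hδle u hu
    simp only [hf] at h4
    linarith
  rcases eq_or_ne ρ 0 with rfl | hρ
  · simp
  have hnorm : 0 < ‖ρ‖ := norm_pos_iff.2 hρ
  have h5 := hsphere (‖ρ‖⁻¹ • ρ) (by simp [norm_smul, hnorm.ne'])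
  have h6 : ∀ i, max (-(ρ ⬝ᵥ gHat (hhat n ω) n (fun i => Z i ω) i)) 0 = ‖ρ‖ *
      max (-((‖ρ‖⁻¹ • ρ) ⬝ᵥ gHat (hhat n ω) n (fun i => Z i ω) i)) 0 := by
    intro i
    rw [mul_max_of_nonneg _ _ hnorm.le, smul_dotProduct, smul_eq_mul, mul_zero, mul_neg,
      mul_inv_cancel_left₀ hnorm.ne']
  simp only [h6]
  rw [← Finset.mul_sum, mul_left_comm, mul_comm]
  exact mul_le_mul_of_nonneg_left h5 hnorm.le

lemma UniformlyClose.wpto_wellPosed (hZ : IsIIDSample P ν Z) (hb : BoundedModel ν h C)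
    (hc : UniformlyClose P Z hhat h) (hpos : ∀ᵐ z ∂ν, 0 < propensity ν q z)
    (hnd : Nondegenerate ν h) :
    WPTO P (fun n ω => WellPosed (hhat n ω) q n (fun i => Z i ω)) := by
  obtain ⟨δ, hδ, hs⟩ := hc.exists_wpto_surrounded hZ hb hpos hnd
  exact hs.mono fun n ω hω => hω.wellPosed hδ

/-- On a small ball around a point of the limiting domain, the objectives converge to the limiting
objective uniformly, and the ball is contained in the polytope. -/
lemma UniformlyClose.wpto_objective (hZ : IsIIDSample P ν Z) (hb : BoundedModel ν h C)
    (hc : UniformlyClose P Z hhat h) {ρ : ι → ℝ} {ε r : ℝ} (hε : 0 < ε)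
    (hρ : ∀ᵐ z ∂ν, trt z = q → ε ≤ limLin ν h ρ (cov z)) (hr0 : 0 ≤ r)
    (hr : Fintype.card ι * (2 * C) * r ≤ ε / 2) {η : ℝ} (hη : 0 < η) :
    WPTO P (fun n ω => ∀ σ ∈ Metric.closedBall ρ r,
      σ ∈ polytope (hhat n ω) q n (fun i => Z i ω) ∧
      |objective (hhat n ω) q n (fun i => Z i ω) σ - limObjective ν h q σ| ≤ η) := by
  set N : ℝ := (Fintype.card ι : ℝ)
  have hN : 0 ≤ N := Nat.cast_nonneg _
  have hC := hb.nonneg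
  have hhalf := hb.half_le_limLin hρ hr
  have hdom : ∀ σ ∈ Metric.closedBall ρ r, σ ∈ limDomain ν h q := fun σ hσ =>
    ⟨ε / 2, half_pos hε, by filter_upwards [hhalf] with z hz hq using hz hq σ hσ⟩
  set f : (ι → ℝ) → Record X Q → ℝ := fun σ z => ind q z * Real.log (limLin ν h σ (cov z)) with hf
  have hfm : ∀ σ, Measurable (f σ) := fun σ => (measurable_ind q).mul
    (Real.measurable_log.comp ((hb.measurable_limLin σ).comp measurable_cov))
  have hlip : ∀ᵐ z ∂ν, ∀ σ ∈ Metric.closedBall ρ r, ∀ τ ∈ Metric.closedBall ρ r,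
      |f σ z - f τ z| ≤ (ε / 2)⁻¹ * (N * (2 * C)) * dist σ τ := by
    filter_upwards [hb.abs_dotProduct_le, hhalf] with z h1 h2 σ hσ τ hτ
    by_cases hz : trt z = q
    · simp only [hf, ind, if_pos hz, one_mul]
      refine (abs_log_sub_log_le_mul (half_pos hε) (h2 hz σ hσ) (h2 hz τ hτ)).trans ?_
      rw [limLin_sub_limLin, mul_assoc, dist_eq_norm]
      exact mul_le_mul_of_nonneg_left (h1 _) (by positivity)
    · simp only [hf, ind, if_neg hz, zero_mul, sub_self, abs_zero]
      positivity
  have hull := hZ.uniform_lln (isCompact_closedBall ρ r) (fun σ _ => hfm σ)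
    (fun σ hσ => hb.integrable_ind_mul_log (hdom σ hσ)) (by positivity) hlip (half_pos hη)
  -- the sample factors differ from the limiting ones by at most `κ ≤ ε / 4`
  set R : ℝ := ‖ρ‖ + r
  have hR : 0 ≤ R := add_nonneg (norm_nonneg _) hr0
  set κ : ℝ := min (ε / 4) ((ε / 4) * (η / 2)) with hκ_def
  have hκ : 0 < κ := lt_min (by positivity) (by positivity)
  have hclose := hc.wpto_gHat hZ hb (η := κ / (N * R + 1)) (by positivity)
  refine ((hull.and hclose).and (hZ.wpto_of_ae hhalf)).mono fun n ω ⟨⟨h1, h2⟩, h3⟩ σ hσ => ?_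
  have hσR : ‖σ‖ ≤ R := by
    have h4 : ‖σ - ρ‖ ≤ r := by simpa [dist_eq_norm] using hσ
    have h5 := norm_add_le ρ (σ - ρ)
    rw [add_sub_cancel] at h5
    change ‖σ‖ ≤ ‖ρ‖ + r
    linarith
  have hlin : ∀ i, |lin (hhat n ω) n (fun i => Z i ω) σ i - limLin ν h σ (cov (Z i ω))| ≤ κ := by
    intro i
    rw [lin, limLin, add_sub_add_left_eq_sub, ← dotProduct_sub]
    refine (abs_dotProduct_le_card fun l => h2 i l).trans ?_
    have h4 : N * (κ / (N * R + 1)) * ‖σ‖ ≤ N * (κ / (N * R + 1)) * R :=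
      mul_le_mul_of_nonneg_left hσR (by positivity)
    refine h4.trans ?_
    rw [mul_right_comm, ← mul_div_assoc, div_le_iff₀ (by positivity)]
    nlinarith
  have hκ4 : κ ≤ ε / 4 := min_le_left _ _
  have hlow : ∀ i ∈ treated q n (fun i => Z i ω),
      ε / 4 ≤ lin (hhat n ω) n (fun i => Z i ω) σ i ∧ ε / 4 ≤ limLin ν h σ (cov (Z i ω)) := by
    intro i hi
    have h4 := h3 i (mem_treated.1 hi).2 σ hσ
    have h5 := (abs_le.1 (hlin i)).1
    constructor <;> linarith
  refine ⟨fun i hi => (by positivity : (0 : ℝ) < ε / 4).trans_le (hlow i hi).1, ?_⟩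
  have hsum : |(n : ℝ)⁻¹ * ∑ i ∈ treated q n (fun i => Z i ω),
        Real.log (lin (hhat n ω) n (fun i => Z i ω) σ i) -
      (n : ℝ)⁻¹ * ∑ i ∈ treated q n (fun i => Z i ω),
        Real.log (limLin ν h σ (cov (Z i ω)))| ≤ η / 2 := by
    refine abs_inv_mul_sum_sub_le (treated_subset _ _ _) (by positivity) fun i hi => ?_
    refine (abs_log_sub_log_le_mul (by positivity) (hlow i hi).1 (hlow i hi).2).trans ?_
    rw [inv_mul_le_iff₀ (by positivity)]
    exact (hlin i).trans (min_le_right _ _)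
  rw [inv_mul_sum_treated q n (fun i => Z i ω)
      (fun z => Real.log (limLin ν h σ (cov z)))] at hsum
  have h6 := h1 σ hσ
  have hF : limObjective ν h q σ = -∫ z, f σ z ∂ν := rfl
  rw [hF, objective]
  rw [abs_le] at *
  constructor <;> linarith

/-- The minimisers converge in probability to the minimiser of the limiting objective. -/
lemma UniformlyClose.tendsto_rhoMin (hZ : IsIIDSample P ν Z) (hb : BoundedModel ν h C)
    (hc : UniformlyClose P Z hhat h) (hpos : ∀ᵐ z ∂ν, 0 < propensity ν q z)
    (hnd : Nondegenerate ν h) {ρ : ι → ℝ} (hρ : ρ ∈ limDomain ν h q)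
    (hmin : IsMinOn (limObjective ν h q) (limDomain ν h q) ρ) {η : ℝ} (hη : 0 < η) :
    WPTO P (fun n ω => dist (rhoMin (hhat n ω) q n (fun i => Z i ω)) ρ < η) := by
  have hρ' := hρ
  obtain ⟨ε, hε, hae⟩ := hρ'
  set N : ℝ := (Fintype.card ι : ℝ)
  have hN : 0 ≤ N := Nat.cast_nonneg _
  have hC := hb.nonneg
  set r : ℝ := min η (ε / 2 / (N * (2 * C) + 1)) with hr_def
  have hr : 0 < r := lt_min hη (by positivity)
  have hrN : N * (2 * C) * r ≤ ε / 2 := by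
    have h1 : (N * (2 * C) + 1) * r ≤ ε / 2 := by
      rw [← le_div_iff₀' (by positivity)]
      exact min_le_right _ _
    nlinarith
  have hhalf := hb.half_le_limLin hae hrN
  have hdom : ∀ σ ∈ Metric.closedBall ρ r, σ ∈ limDomain ν h q := fun σ hσ =>
    ⟨ε / 2, half_pos hε, by filter_upwards [hhalf] with z hz hq using hz hq σ hσ⟩
  -- the limiting objective exceeds its minimum by a margin on the sphere, by compactness:
  -- it is Lipschitz on the ball
  obtain ⟨m, hm, hmargin⟩ : ∃ m > 0, ∀ τ ∈ Metric.sphere ρ r,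
      limObjective ν h q ρ + m ≤ limObjective ν h q τ := by
    rcases (Metric.sphere ρ r).eq_empty_or_nonempty with he | hne
    · exact ⟨1, one_pos, by simp [he]⟩
    have hL : 0 ≤ (ε / 2)⁻¹ * (N * (2 * C)) := by positivity
    have hcont : ContinuousOn (limObjective ν h q) (Metric.closedBall ρ r) := by
      refine (LipschitzOnWith.of_dist_le_mul (K := ⟨_, hL⟩) fun σ hσ τ hτ => ?_).continuousOn
      have hiσ := hb.integrable_ind_mul_log (hdom σ hσ)
      have hiτ := hb.integrable_ind_mul_log (hdom τ hτ)
      have hFσ : limObjective ν h q σ = -∫ z, ind q z * Real.log (limLin ν h σ (cov z)) ∂ν := rfl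
      have hFτ : limObjective ν h q τ = -∫ z, ind q z * Real.log (limLin ν h τ (cov z)) ∂ν := rfl
      rw [hFσ, hFτ, dist_neg_neg, dist_eq_norm, ← integral_sub hiσ hiτ]
      have := norm_integral_le_of_norm_le_const (μ := ν)
        (C := (ε / 2)⁻¹ * (N * (2 * C)) * dist σ τ)
        (f := fun z => ind q z * Real.log (limLin ν h σ (cov z)) -
          ind q z * Real.log (limLin ν h τ (cov z))) (by
        filter_upwards [hb.abs_dotProduct_le, hhalf] with z h1 h2
        by_cases hz : trt z = q
        · simp only [ind, if_pos hz, one_mul]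
          refine (abs_log_sub_log_le_mul (half_pos hε) (h2 hz σ hσ) (h2 hz τ hτ)).trans ?_
          rw [limLin_sub_limLin, mul_assoc, dist_eq_norm]
          exact mul_le_mul_of_nonneg_left (h1 _) (by positivity)
        · simp only [ind, if_neg hz, zero_mul, sub_self, norm_zero]
          positivity)
      change _ ≤ (ε / 2)⁻¹ * (N * (2 * C)) * dist σ τ
      simpa using this
    obtain ⟨τ₀, hτ₀, hτmin⟩ := (isCompact_sphere ρ r).exists_isMinOn hne
      (hcont.mono Metric.sphere_subset_closedBall)
    have hne₀ : τ₀ ≠ ρ := by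
      rintro rfl
      rw [mem_sphere_iff_norm, sub_self, norm_zero] at hτ₀
      exact hr.ne hτ₀
    refine ⟨limObjective ν h q τ₀ - limObjective ν h q ρ, sub_pos.2 (hb.limObjective_lt hpos hnd hρ
      hmin (hdom τ₀ (Metric.sphere_subset_closedBall hτ₀)) hne₀), fun τ hτ => ?_⟩
    rw [add_sub_cancel]
    exact hτmin hτ
  have hobj := hc.wpto_objective hZ hb hε hae hr.le hrN (η := m / 3) (by positivity)
  refine (hobj.and (hc.wpto_wellPosed hZ hb hpos hnd)).mono fun n ω ⟨h1, h2⟩ => ?_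
  obtain ⟨hP, hFρ⟩ := h1 ρ (Metric.mem_closedBall_self hr.le)
  refine (h2.2.2.2.2.1.dist_lt hr hP fun τ hτ => ?_).trans_le (min_le_left _ _)
  have h3 := (h1 τ (Metric.sphere_subset_closedBall hτ)).2
  have h4 := hmargin τ hτ
  rw [abs_le] at h3 hFρ
  linarith

end FittedModels

section Estimator

variable {Ω : Type*} [MeasurableSpace Ω] {P : Measure Ω} [IsProbabilityMeasure P]
  {X : Type*} [MeasurableSpace X] {Q : ℕ} {ν : Measure (Record X Q)} [IsProbabilityMeasure ν]
  {Z : ℕ → Ω → Record X Q} {ι : Type*} [Fintype ι] {hhat : ℕ → Ω → X → ι → ℝ} {h : X → ι → ℝ}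
  {q : Fin Q} {C : ℝ} {ρ : ι → ℝ}

/-- If the minimisers converge to `ρ`, then the sample factors `1 + ρ̂ᵀ ĝ_i` converge to
`1 + ρᵀ g(X_i)`, uniformly over the treated units, and stay bounded away from zero. -/
lemma UniformlyClose.wpto_lin (hZ : IsIIDSample P ν Z) (hb : BoundedModel ν h C)
    (hc : UniformlyClose P Z hhat h) {ε : ℝ} (hε : 0 < ε)
    (hρ : ∀ᵐ z ∂ν, trt z = q → ε ≤ limLin ν h ρ (cov z))
    (hconv : ∀ η > 0, WPTO P (fun n ω => dist (rhoMin (hhat n ω) q n (fun i => Z i ω)) ρ < η))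
    {η : ℝ} (hη : 0 < η) :
    WPTO P (fun n ω => ∀ i ∈ treated q n (fun i => Z i ω),
      ε / 2 ≤ lin (hhat n ω) n (fun i => Z i ω) (rhoMin (hhat n ω) q n (fun i => Z i ω)) i ∧
      ε / 2 ≤ limLin ν h ρ (cov (Z i ω)) ∧
      |lin (hhat n ω) n (fun i => Z i ω) (rhoMin (hhat n ω) q n (fun i => Z i ω)) i -
        limLin ν h ρ (cov (Z i ω))| ≤ η) := by
  have hC := hb.nonneg
  set N : ℝ := (Fintype.card ι : ℝ)
  have hN : 0 ≤ N := Nat.cast_nonneg _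
  set D : ℝ := N * (2 * C + 1 + ‖ρ‖)
  have hD : 0 ≤ D := by positivity
  set η' : ℝ := min η (ε / 2)
  have hη' : 0 < η' := lt_min hη (half_pos hε)
  set κ : ℝ := min 1 (η' / (D + 1))
  have hκ : 0 < κ := lt_min one_pos (by positivity)
  have hκD : D * κ ≤ η' := by
    have h1 : (D + 1) * κ ≤ η' := by
      rw [← le_div_iff₀' (by positivity)]
      exact min_le_right _ _
    linarith
  refine (((hc.wpto_gHat hZ hb hκ).and (hconv κ hκ)).and
    (hZ.wpto_of_ae (hb.abs_gLim_le.and hρ))).mono fun n ω ⟨⟨h1, h2⟩, h3⟩ i hi => ?_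
  set ρhat := rhoMin (hhat n ω) q n (fun i => Z i ω)
  set ghat := gHat (hhat n ω) n (fun i => Z i ω) i
  set g := gLim ν h (cov (Z i ω))
  have hbound : ∀ l, |ghat l| ≤ 2 * C + 1 := fun l => by
    have h4 := abs_add_le (ghat l - g l) (g l)
    rw [sub_add_cancel] at h4
    have h5 : κ ≤ 1 := min_le_left _ _
    linarith [h1 i l, (h3 i).1 l]
  have hclose : |lin (hhat n ω) n (fun i => Z i ω) ρhat i - limLin ν h ρ (cov (Z i ω))| ≤ η' := by
    have hsplit : lin (hhat n ω) n (fun i => Z i ω) ρhat i - limLin ν h ρ (cov (Z i ω)) =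
        (ρhat - ρ) ⬝ᵥ ghat + ρ ⬝ᵥ (ghat - g) := by
      rw [lin, limLin, sub_dotProduct, dotProduct_sub]
      ring
    rw [hsplit]
    have h6 := abs_dotProduct_le_card (ρ := ρhat - ρ) hbound
    have h7 := abs_dotProduct_le_card (ρ := ρ) (v := ghat - g) fun l => h1 i l
    have h8 : N * (2 * C + 1) * ‖ρhat - ρ‖ ≤ N * (2 * C + 1) * κ := by
      rw [← dist_eq_norm]
      exact mul_le_mul_of_nonneg_left h2.le (by positivity)
    calc _ ≤ _ := abs_add_le _ _
      _ ≤ N * (2 * C + 1) * κ + N * κ * ‖ρ‖ := add_le_add (h6.trans h8) h7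
      _ = D * κ := by ring
      _ ≤ η' := hκD
  have hlow := (h3 i).2 (mem_treated.1 hi).2
  have h9 : η' ≤ ε / 2 := min_le_right _ _
  have h10 := (abs_le.1 hclose).1
  exact ⟨by linarith, by linarith, hclose.trans (min_le_left _ _)⟩

/-- Convergence of the averages weighted by `1 / (1 + ρ̂ᵀ ĝ_i)`. -/
lemma UniformlyClose.wpto_weighted (hZ : IsIIDSample P ν Z) (hb : BoundedModel ν h C)
    (hc : UniformlyClose P Z hhat h) (hρ : ρ ∈ limDomain ν h q)
    (hconv : ∀ η > 0, WPTO P (fun n ω => dist (rhoMin (hhat n ω) q n (fun i => Z i ω)) ρ < η))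
    {W : Record X Q → ℝ} (hWm : Measurable W) (hW : Integrable W ν) {η : ℝ} (hη : 0 < η) :
    WPTO P (fun n ω => |(n : ℝ)⁻¹ * ∑ i ∈ treated q n (fun i => Z i ω), W (Z i ω) *
        (lin (hhat n ω) n (fun i => Z i ω) (rhoMin (hhat n ω) q n (fun i => Z i ω)) i)⁻¹ -
      ∫ z, W z * (ind q z * (limLin ν h ρ (cov z))⁻¹) ∂ν| ≤ η) := by
  have hint := hb.integrable_mul_ind_mul_inv hρ hW
  obtain ⟨ε, hε, hae⟩ := hρ
  have hlln := hZ.lln (f := fun z => W z * (ind q z * (limLin ν h ρ (cov z))⁻¹))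
    (hWm.mul (hb.measurable_ind_mul_inv q ρ)) hint (half_pos hη)
  have habs := hZ.lln (continuous_abs.measurable.comp hWm) hW.abs one_pos
  set M : ℝ := ∫ z, |W z| ∂ν + 1
  have hM : 0 < M := add_pos_of_nonneg_of_pos (integral_nonneg fun _ => abs_nonneg _) one_pos
  have hlin := hc.wpto_lin hZ hb hε hae hconv
    (η := ε / 2 * (ε / 2) * (η / (2 * M))) (by positivity)
  refine ((hlln.and habs).and hlin).mono fun n ω ⟨⟨h1, h2⟩, h3⟩ => ?_
  set T := treated q n (fun i => Z i ω)
  set L := lin (hhat n ω) n (fun i => Z i ω) (rhoMin (hhat n ω) q n (fun i => Z i ω))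
  have hemp : (n : ℝ)⁻¹ * ∑ i ∈ T, W (Z i ω) * (limLin ν h ρ (cov (Z i ω)))⁻¹ =
      empMean (fun z => W z * (ind q z * (limLin ν h ρ (cov z))⁻¹)) n (fun i => Z i ω) := by
    rw [inv_mul_sum_treated q n (fun i => Z i ω) (fun z => W z * (limLin ν h ρ (cov z))⁻¹)]
    simp only [mul_left_comm]
  have hWsum : (n : ℝ)⁻¹ * ∑ i ∈ T, |W (Z i ω)| ≤ M := by
    have h4 : (n : ℝ)⁻¹ * ∑ i ∈ T, |W (Z i ω)| ≤ empMean (fun z => |W z|) n (fun i => Z i ω) :=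
      mul_le_mul_of_nonneg_left (Finset.sum_le_sum_of_subset_of_nonneg (treated_subset _ _ _)
        fun _ _ _ => abs_nonneg _) (by positivity)
    have h5 := (abs_le.1 h2).2
    simp only [Function.comp_def] at h5
    linarith
  have hdiff : |(n : ℝ)⁻¹ * ∑ i ∈ T, W (Z i ω) * (L i)⁻¹ -
      (n : ℝ)⁻¹ * ∑ i ∈ T, W (Z i ω) * (limLin ν h ρ (cov (Z i ω)))⁻¹| ≤ η / 2 := by
    rw [← mul_sub, ← Finset.sum_sub_distrib, abs_mul, abs_of_nonneg (by positivity)]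
    have h6 : |∑ i ∈ T, (W (Z i ω) * (L i)⁻¹ - W (Z i ω) * (limLin ν h ρ (cov (Z i ω)))⁻¹)| ≤
        (∑ i ∈ T, |W (Z i ω)|) * (η / (2 * M)) := by
      rw [Finset.sum_mul]
      refine (Finset.abs_sum_le_sum_abs _ _).trans (Finset.sum_le_sum fun i hi => ?_)
      obtain ⟨g1, g2, g3⟩ := h3 i hi
      rw [← mul_sub, abs_mul]
      refine mul_le_mul_of_nonneg_left ?_ (abs_nonneg _)
      refine (abs_inv_sub_inv_le (half_pos hε) g1 g2).trans ?_
      rwa [inv_mul_le_iff₀ (by positivity)]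
    calc (n : ℝ)⁻¹ * _ ≤ (n : ℝ)⁻¹ * ((∑ i ∈ T, |W (Z i ω)|) * (η / (2 * M))) :=
          mul_le_mul_of_nonneg_left h6 (by positivity)
      _ = ((n : ℝ)⁻¹ * ∑ i ∈ T, |W (Z i ω)|) * (η / (2 * M)) := by ring
      _ ≤ M * (η / (2 * M)) := mul_le_mul_of_nonneg_right hWsum (by positivity)
      _ = η / 2 := by field_simp
  rw [hemp] at hdiff
  rw [abs_le] at *
  constructor <;> linarith

/-- The estimator is a ratio of two weighted averages. -/
lemma muHat_eq_div {X : Type*} {ι : Type*} [Fintype ι] (h : X → ι → ℝ) (q : Fin Q) (n : ℕ)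
    (z : ℕ → Record X Q) : muHat h q n z =
      ((n : ℝ)⁻¹ * ∑ i ∈ treated q n z, obsY (z i) * (lin h n z (rhoMin h q n z) i)⁻¹) /
        ((n : ℝ)⁻¹ * ∑ i ∈ treated q n z, 1 * (lin h n z (rhoMin h q n z) i)⁻¹) := by
  rcases (treated q n z).eq_empty_or_nonempty with he | ⟨j, hj⟩
  · simp [muHat, he]
  have hn : (n : ℝ)⁻¹ ≠ 0 := by
    have := (mem_treated.1 hj).1
    have : (n : ℝ) ≠ 0 := by exact_mod_cast (Nat.zero_lt_of_lt this).ne'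
    exact inv_ne_zero this
  have hcard : ((treated q n z).card : ℝ)⁻¹ ≠ 0 :=
    inv_ne_zero (by exact_mod_cast (Finset.card_pos.2 ⟨j, hj⟩).ne')
  rw [mul_div_mul_left _ _ hn, Finset.sum_div]
  refine Finset.sum_congr rfl fun i _ => ?_
  simp only [weight, one_mul]
  rw [mul_div_mul_left _ _ hcard]
  ring

/-- If the minimisers converge to `ρ`, then the estimator converges to the mean `m` of `Y` under the
weights `1{D = q} / (1 + ρᵀ g(X))`. -/
lemma UniformlyClose.tendsto_muHat (hZ : IsIIDSample P ν Z) (hb : BoundedModel ν h C)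
    (hc : UniformlyClose P Z hhat h) (hpos : ∀ᵐ z ∂ν, 0 < propensity ν q z)
    (hY : ∀ d, Integrable (pot d) ν) (hρ : ρ ∈ limDomain ν h q)
    (hconv : ∀ η > 0, WPTO P (fun n ω => dist (rhoMin (hhat n ω) q n (fun i => Z i ω)) ρ < η))
    {m : ℝ} (hm : ∫ z, obsY z * (ind q z * (limLin ν h ρ (cov z))⁻¹) ∂ν =
      m * ∫ z, 1 * (ind q z * (limLin ν h ρ (cov z))⁻¹) ∂ν) :
    TendstoInMeasure P (fun n ω => muHat (hhat n ω) q n (fun i => Z i ω)) atTop (fun _ => m) := by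
  rw [tendstoInMeasure_const_iff_wpto]
  intro η hη
  have hB := hb.integral_ind_mul_inv_pos hpos hρ
  set B := ∫ z, 1 * (ind q z * (limLin ν h ρ (cov z))⁻¹) ∂ν
  have hK : 0 < 1 + |m| := add_pos_of_pos_of_nonneg one_pos (abs_nonneg m)
  -- the ratio is within `κ (1 + |m|) / (B / 2) ≤ η / 2` of `m`
  set κ : ℝ := min (B / 2) (η / 2 * (B / 2) / (1 + |m|))
  have hκ : 0 < κ := lt_min (half_pos hB) (by positivity)
  refine ((hc.wpto_weighted hZ hb hρ hconv measurable_obsY (integrable_obsY hY) hκ).and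
    (hc.wpto_weighted hZ hb hρ hconv (W := fun _ => 1) measurable_const (integrable_const 1)
      hκ)).mono fun n ω ⟨h1, h2⟩ => ?_
  rw [muHat_eq_div, Real.dist_eq]
  rw [hm] at h1
  set num := (n : ℝ)⁻¹ * ∑ i ∈ treated q n (fun i => Z i ω), obsY (Z i ω) *
    (lin (hhat n ω) n (fun i => Z i ω) (rhoMin (hhat n ω) q n (fun i => Z i ω)) i)⁻¹
  set den := (n : ℝ)⁻¹ * ∑ i ∈ treated q n (fun i => Z i ω), 1 *
    (lin (hhat n ω) n (fun i => Z i ω) (rhoMin (hhat n ω) q n (fun i => Z i ω)) i)⁻¹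
  have hκB : κ ≤ B / 2 := min_le_left _ _
  have hden : B / 2 ≤ den := by
    have := (abs_le.1 h2).1
    linarith
  have hden0 : 0 < den := (half_pos hB).trans_le hden
  have hκK : κ * (1 + |m|) ≤ η / 2 * (B / 2) := by
    rw [← le_div_iff₀ hK]
    exact min_le_right _ _
  have hnum : |num - m * den| ≤ κ * (1 + |m|) := by
    have : num - m * den = (num - m * B) - m * (den - B) := by ring
    rw [this]
    refine (abs_sub _ _).trans ?_
    rw [abs_mul]
    have := mul_le_mul_of_nonneg_left h2 (abs_nonneg m)
    linarith
  have hratio : num / den - m = (num - m * den) / den := by field_simp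
  rw [hratio, abs_div, abs_of_pos hden0, div_lt_iff₀ hden0]
  have := mul_le_mul_of_nonneg_left hden hη.le
  have := mul_pos hη hB
  linarith

/-- The limiting estimating equation `E[1{D = q} g_l(X) / (1 + ρᵀ g(X))] = 0`: the empirical
estimating equation holds at the minimisers, and both sides converge. -/
lemma UniformlyClose.integral_gLim_mul_eq_zero (hZ : IsIIDSample P ν Z) (hb : BoundedModel ν h C)
    (hc : UniformlyClose P Z hhat h) (hpos : ∀ᵐ z ∂ν, 0 < propensity ν q z)
    (hnd : Nondegenerate ν h) (hρ : ρ ∈ limDomain ν h q)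
    (hconv : ∀ η > 0, WPTO P (fun n ω => dist (rhoMin (hhat n ω) q n (fun i => Z i ω)) ρ < η))
    (l : ι) :
    ∫ z, gLim ν h (cov z) l * (ind q z * (limLin ν h ρ (cov z))⁻¹) ∂ν = 0 := by
  obtain ⟨ε, hε, hae⟩ := id hρ
  refine abs_eq_zero.1 (le_antisymm (le_of_forall_pos_le_add fun η hη => ?_) (abs_nonneg _))
  obtain ⟨n, ω, ⟨⟨h1, h2⟩, h3⟩, h4⟩ := ((((hc.wpto_weighted hZ hb hρ hconv
    ((hb.measurable_gLim l).comp measurable_cov) (hb.integrable_gLim l) (half_pos hη)).and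
    (hc.wpto_wellPosed (q := q) hZ hb hpos hnd)).and
    (hc.wpto_lin hZ hb hε hae hconv one_pos)).and
    (hc.wpto_gHat hZ hb (η := ε / 2 * (η / 2)) (by positivity))).exists
  have hee := h2.2.2.2.2.2.2 l
  set L := lin (hhat n ω) n (fun i => Z i ω) (rhoMin (hhat n ω) q n (fun i => Z i ω))
  have h5 : |(n : ℝ)⁻¹ * ∑ i ∈ treated q n (fun i => Z i ω), gLim ν h (cov (Z i ω)) l * (L i)⁻¹ -
      (n : ℝ)⁻¹ * ∑ i ∈ treated q n (fun i => Z i ω),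
        gHat (hhat n ω) n (fun i => Z i ω) i l / L i| ≤ η / 2 := by
    refine abs_inv_mul_sum_sub_le (treated_subset _ _ _) (half_pos hη).le fun i hi => ?_
    have h6 := (h3 i hi).1
    have h7 : 0 < L i := (half_pos hε).trans_le h6
    rw [div_eq_mul_inv, ← sub_mul, abs_mul, abs_of_pos (inv_pos.2 h7), ← div_eq_mul_inv,
      div_le_iff₀ h7, abs_sub_comm]
    refine (h4 i l).trans ?_
    rw [mul_comm]
    exact mul_le_mul_of_nonneg_left h6 (half_pos hη).le
  rw [hee, mul_zero, sub_zero] at h5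
  simp only [Function.comp_def] at h1
  rw [abs_le] at *
  constructor <;> linarith

end Estimator

/-! ### A correct propensity score model, and a correct outcome regression model -/

section CorrectModels

variable {X : Type*} [MeasurableSpace X] {Q : ℕ} {ν : Measure (Record X Q)}
  {ι : Type*} [Fintype ι] {h : X → ι → ℝ} {q : Fin Q} {C c : ℝ} {l₀ : ι}

/-- If component `l₀` is the propensity score, then `ρ = e_{l₀} / θ` with `θ = E[π(q | X)]` gives
`1 + ρᵀ g(X) = π(q | X) / θ`. -/
lemma limLin_single [DecidableEq ι] {θ : ℝ} (hθ : θ = ∫ z, h (cov z) l₀ ∂ν) (hθ0 : 0 < θ) (x : X) :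
    limLin ν h (Pi.single l₀ θ⁻¹) x = h x l₀ / θ := by
  rw [limLin, single_dotProduct, gLim, ← hθ]
  field_simp
  ring

variable [IsProbabilityMeasure ν]

/-- If component `l₀` is the propensity score, then the limiting objective is minimal at
`e_{l₀} / θ`: by the tangent line of the logarithm, the difference of the objectives is bounded by
the mean of the centred vector `g(X)`. -/
lemma BoundedModel.isMinOn_single [DecidableEq ι] (hb : BoundedModel ν h C) (hc0 : 0 < c)
    (hc : ∀ᵐ z ∂ν, c ≤ propensity ν q z)
    (hps : (fun z : Record X Q => h (cov z) l₀) =ᵐ[ν] propensity ν q) {θ : ℝ}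
    (hθ : θ = ∫ z, h (cov z) l₀ ∂ν) :
    0 < θ ∧ (∀ᵐ z ∂ν, c / θ ≤ limLin ν h (Pi.single l₀ θ⁻¹) (cov z)) ∧
    Pi.single l₀ θ⁻¹ ∈ limDomain ν h q ∧
      IsMinOn (limObjective ν h q) (limDomain ν h q) (Pi.single l₀ θ⁻¹) := by
  have hc' : ∀ᵐ z ∂ν, c ≤ h (cov z) l₀ := by
    filter_upwards [hc, hps] with z h1 h2
    rwa [h2]
  have hθ0 : 0 < θ := hc0.trans_le (hθ ▸ hb.le_integral hc')
  set ρ : ι → ℝ := Pi.single l₀ θ⁻¹ with hρ_def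
  have hlow : ∀ᵐ z ∂ν, c / θ ≤ limLin ν h ρ (cov z) := by
    filter_upwards [hc'] with z hz
    rw [hρ_def, limLin_single hθ hθ0]
    gcongr
  have hcθ : 0 < c / θ := div_pos hc0 hθ0
  have hdom : ρ ∈ limDomain ν h q := ⟨c / θ, hcθ, hlow.mono fun _ hz _ => hz⟩
  refine ⟨hθ0, hlow, hdom, fun σ hσ => ?_⟩
  have iρ := hb.integrable_ind_mul_log hdom
  have iσ := hb.integrable_ind_mul_log hσ
  obtain ⟨ε, hε, hae⟩ := hσ
  set w : X → ℝ := fun x => ((σ - ρ) ⬝ᵥ gLim ν h x) * (limLin ν h ρ x)⁻¹ with hw_def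
  have hwm : Measurable w := (hb.measurable_dotProduct _).mul (hb.measurable_limLin ρ).inv
  have hwb : ∀ᵐ z ∂ν, |w (cov z)| ≤ Fintype.card ι * (2 * C) * ‖σ - ρ‖ * (c / θ)⁻¹ := by
    filter_upwards [hb.abs_dotProduct_le, hlow] with z h1 h2
    rw [hw_def, abs_mul, abs_of_pos (inv_pos.2 (hcθ.trans_le h2))]
    exact mul_le_mul (h1 _) (inv_anti₀ hcθ h2) (inv_nonneg.2 (hcθ.le.trans h2))
      ((abs_nonneg _).trans (h1 _))
  have hwi : Integrable (fun z => ind q z * w (cov z)) ν :=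
    (integrable_ind q).mul_bdd (hwm.comp measurable_cov).aestronglyMeasurable hwb
  have hzero : ∫ z, ind q z * w (cov z) ∂ν = 0 := by
    rw [integral_mul_eq_integral_condExp_mul (sigmaCov_le X Q) (integrable_ind q)
      (stronglyMeasurable_comp_cov hwm) hwb, ← mul_zero θ, ← hb.integral_dotProduct (σ - ρ),
      ← integral_const_mul]
    refine integral_congr_ae ?_
    filter_upwards [hps, hc'] with z h1 h2
    have h3 : h (cov z) l₀ ≠ 0 := (hc0.trans_le h2).ne'
    change propensity ν q z * w (cov z) = _
    rw [← h1, hw_def, hρ_def]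
    simp only
    rw [limLin_single hθ hθ0, inv_div]
    field_simp
  have hle : ∫ z, (ind q z * Real.log (limLin ν h σ (cov z)) -
      ind q z * Real.log (limLin ν h ρ (cov z))) ∂ν ≤ ∫ z, ind q z * w (cov z) ∂ν := by
    refine integral_mono_ae (iσ.sub iρ) hwi ?_
    filter_upwards [hae, hlow] with z h1 h2
    rw [← mul_sub]
    by_cases hq : trt z = q
    · refine mul_le_mul_of_nonneg_left ?_ (ind_nonneg q z)
      rw [hw_def]
      simp only
      rw [← limLin_sub_limLin, ← div_eq_mul_inv]
      exact log_sub_log_le_div (hcθ.trans_le h2) (hε.trans_le (h1 hq))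
    · simp [ind, hq]
  rw [hzero, integral_sub iσ iρ] at hle
  have hFρ : limObjective ν h q ρ = -∫ z, ind q z * Real.log (limLin ν h ρ (cov z)) ∂ν := rfl
  have hFσ : limObjective ν h q σ = -∫ z, ind q z * Real.log (limLin ν h σ (cov z)) ∂ν := rfl
  change limObjective ν h q ρ ≤ limObjective ν h q σ
  rw [hFρ, hFσ]
  linarith

variable [StandardBorelSpace X]

/-- With a correct propensity score model, the limiting weights are proportional to
`1{D = q} / π(q | X)`. -/
lemma BoundedModel.integral_obsY_of_propensity [DecidableEq ι] (hb : BoundedModel ν h C)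
    (hc0 : 0 < c)
    (hc : ∀ᵐ z ∂ν, c ≤ propensity ν q z)
    (hps : (fun z : Record X Q => h (cov z) l₀) =ᵐ[ν] propensity ν q)
    (hun : Unconfounded ν q) (hY : Integrable (pot q) ν) {θ : ℝ}
    (hθ : θ = ∫ z, h (cov z) l₀ ∂ν) :
    ∫ z, obsY z * (ind q z * (limLin ν h (Pi.single l₀ θ⁻¹) (cov z))⁻¹) ∂ν =
      apo ν q * ∫ z, 1 * (ind q z * (limLin ν h (Pi.single l₀ θ⁻¹) (cov z))⁻¹) ∂ν := by
  obtain ⟨hθ0, hlow, -, -⟩ := hb.isMinOn_single hc0 hc hps hθ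
  have hcθ : 0 < c / θ := div_pos hc0 hθ0
  have hwm : Measurable fun x => (limLin ν h (Pi.single l₀ θ⁻¹) x)⁻¹ :=
    (hb.measurable_limLin _).inv
  have hwb : ∀ᵐ z ∂ν, |(limLin ν h (Pi.single l₀ θ⁻¹) (cov z))⁻¹| ≤ (c / θ)⁻¹ := by
    filter_upwards [hlow] with z hz
    rw [abs_of_pos (inv_pos.2 (hcθ.trans_le hz))]
    exact inv_anti₀ hcθ hz
  have hwπ : ∀ᵐ z ∂ν, propensity ν q z * (limLin ν h (Pi.single l₀ θ⁻¹) (cov z))⁻¹ = θ := by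
    filter_upwards [hps, hc] with z h1 h2
    have h3 : propensity ν q z ≠ 0 := (hc0.trans_le h2).ne'
    rw [limLin_single hθ hθ0, h1, inv_div]
    field_simp
  have h1 : ∫ z, obsY z * (ind q z * (limLin ν h (Pi.single l₀ θ⁻¹) (cov z))⁻¹) ∂ν =
      θ * apo ν q := by
    rw [← hun.integral_ind_mul_pot_mul hY hwm hwb hwπ]
    refine integral_congr_ae (ae_of_all _ fun z => ?_)
    simp only
    rw [← ind_mul_obsY]
    ring
  have h2 : ∫ z, 1 * (ind q z * (limLin ν h (Pi.single l₀ θ⁻¹) (cov z))⁻¹) ∂ν = θ := by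
    simp only [one_mul]
    rw [integral_mul_eq_integral_condExp_mul (sigmaCov_le X Q) (integrable_ind q)
      (stronglyMeasurable_comp_cov hwm) hwb]
    refine (integral_congr_ae hwπ).trans ?_
    simp
  rw [h1, h2, mul_comm]

/-- With a correct outcome regression model in component `l`, the weighted mean of `Y` is that of
`a(X, q)`, which by the limiting estimating equation is `E[a(X, q)] = μ(q)`. -/
lemma BoundedModel.integral_obsY_of_outcomeReg (hb : BoundedModel ν h C)
    (hpos : ∀ᵐ z ∂ν, 0 < propensity ν q z) (hun : Unconfounded ν q)
    (hY : ∀ d, Integrable (pot d) ν) {ρ : ι → ℝ} (hρ : ρ ∈ limDomain ν h q) {l : ι}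
    (hreg : ∀ᵐ z ∂ν, trt z = q → h (cov z) l = outcomeReg ν z)
    (hee : ∫ z, gLim ν h (cov z) l * (ind q z * (limLin ν h ρ (cov z))⁻¹) ∂ν = 0) :
    ∫ z, obsY z * (ind q z * (limLin ν h ρ (cov z))⁻¹) ∂ν =
      apo ν q * ∫ z, 1 * (ind q z * (limLin ν h ρ (cov z))⁻¹) ∂ν := by
  have hμ := hun.integral_eq_apo hY hpos (hb.measurable l) (hb.bounded.mono fun _ hz => hz l) hreg
  have i1 := hb.integrable_mul_ind_mul_inv hρ (hb.integrable l)
  have i2 := hb.integrable_mul_ind_mul_inv hρ (integrable_const (μ := ν) (1 : ℝ))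
  obtain ⟨ε, hε, hae⟩ := hρ
  have hbd := abs_ind_mul_inv_limLin_le hε hae
  have h1 : ∫ z, obsY z * (ind q z * (limLin ν h ρ (cov z))⁻¹) ∂ν =
      ∫ z, h (cov z) l * (ind q z * (limLin ν h ρ (cov z))⁻¹) ∂ν := by
    rw [integral_mul_eq_integral_condExp_mul sigmaCovTrt_le (integrable_obsY hY)
      (stronglyMeasurable_ind_mul_comp_cov q (w := fun x => (limLin ν h ρ x)⁻¹)
        (hb.measurable_limLin ρ).inv) hbd]
    refine integral_congr_ae ?_
    filter_upwards [hreg] with z hz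
    by_cases hq : trt z = q
    · simp only [hz hq, outcomeReg]
    · simp [ind, hq]
  have h2 : ∀ z : Record X Q, gLim ν h (cov z) l * (ind q z * (limLin ν h ρ (cov z))⁻¹) =
      h (cov z) l * (ind q z * (limLin ν h ρ (cov z))⁻¹) -
        apo ν q * (1 * (ind q z * (limLin ν h ρ (cov z))⁻¹)) := by
    intro z
    rw [gLim, hμ]
    ring
  simp only [h2] at hee
  rw [integral_sub i1 (i2.const_mul _), integral_const_mul] at hee
  rw [h1]
  linarith

end CorrectModels

/-! ### The postulated models -/

section PostulatedModels

variable {X : Type*} [MeasurableSpace X] {Q : ℕ} {ν : Measure (Record X Q)} {J K : ℕ}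
  {A : Fin J → Type*} {B : Fin K → Type*} {ps : ∀ j, X → Fin Q → A j → ℝ}
  {om : ∀ k, X → Fin Q → B k → ℝ} {q : Fin Q} {αs : ∀ j, A j} {βs : ∀ k, B k}
  [∀ j, PseudoMetricSpace (A j)] [∀ k, PseudoMetricSpace (B k)]

lemma exists_boundedModel_modelVec (h_ps_meas : ∀ j d α, Measurable fun x => ps j x d α)
    (h_om_meas : ∀ k d β, Measurable fun x => om k x d β)
    (h_ps_reg : ∀ j, RegularAt ν (ps j) q (αs j)) (h_om_reg : ∀ k, RegularAt ν (om k) q (βs k)) :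
    ∃ C, BoundedModel ν (modelVec ps om q αs βs) C := by
  choose Cp hCp using fun j => (h_ps_reg j).1
  choose Co hCo using fun k => (h_om_reg k).1
  have hp0 : 0 ≤ ∑ j, |Cp j| := Finset.sum_nonneg fun _ _ => abs_nonneg _
  have ho0 : 0 ≤ ∑ k, |Co k| := Finset.sum_nonneg fun _ _ => abs_nonneg _
  refine ⟨∑ j, |Cp j| + ∑ k, |Co k|, add_nonneg hp0 ho0, ?_, ?_⟩
  · rintro (j | k)
    · exact h_ps_meas j q (αs j)
    · exact h_om_meas k q (βs k)
  · filter_upwards [ae_all_iff.2 hCp, ae_all_iff.2 hCo] with z h1 h2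
    rintro (j | k)
    · have h3 := Finset.single_le_sum (f := fun j => |Cp j|) (fun _ _ => abs_nonneg _)
        (Finset.mem_univ j)
      exact (h1 j).trans ((le_abs_self _).trans (h3.trans (le_add_of_nonneg_right ho0)))
    · have h3 := Finset.single_le_sum (f := fun k => |Co k|) (fun _ _ => abs_nonneg _)
        (Finset.mem_univ k)
      exact (h2 k).trans ((le_abs_self _).trans (h3.trans (le_add_of_nonneg_left hp0)))

variable {Ω : Type*} [MeasurableSpace Ω] {P : Measure Ω}
  {Z : ℕ → Ω → Record X Q}

/-- Uniform continuity in the parameter turns convergence in probability of the parameters into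
convergence of the fitted models, uniformly over the sample. -/
lemma IsIIDSample.wpto_model_close (hZ : IsIIDSample P ν Z) {T : Type*} [PseudoMetricSpace T]
    {m : X → Fin Q → T → ℝ} {t : T} (hm : RegularAt ν m q t) {that : ℕ → Ω → T}
    (ht : TendstoInMeasure P that atTop (fun _ => t)) {η : ℝ} (hη : 0 < η) :
    WPTO P (fun n ω => ∀ i, |m (cov (Z i ω)) q (that n ω) - m (cov (Z i ω)) q t| ≤ η) := by
  obtain ⟨δ, hδ, hae⟩ := hm.2 η hη
  exact ((tendstoInMeasure_const_iff_wpto.1 ht δ hδ).and (hZ.wpto_of_ae hae)).mono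
    fun n ω ⟨h1, h2⟩ i => h2 i _ h1

lemma IsIIDSample.uniformlyClose_modelVec (hZ : IsIIDSample P ν Z)
    (h_ps_reg : ∀ j, RegularAt ν (ps j) q (αs j)) (h_om_reg : ∀ k, RegularAt ν (om k) q (βs k))
    {αhat : ℕ → Ω → ∀ j, A j} {βhat : ℕ → Ω → ∀ k, B k}
    (h_α : ∀ j, TendstoInMeasure P (fun n ω => αhat n ω j) atTop (fun _ => αs j))
    (h_β : ∀ k, TendstoInMeasure P (fun n ω => βhat n ω k) atTop (fun _ => βs k)) :
    UniformlyClose P Z (fun n ω => modelVec ps om q (αhat n ω) (βhat n ω))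
      (modelVec ps om q αs βs) := by
  intro η hη
  refine ((WPTO.forall_fintype fun j => hZ.wpto_model_close (h_ps_reg j) (h_α j) hη).and
    (WPTO.forall_fintype fun k => hZ.wpto_model_close (h_om_reg k) (h_β k) hη)).mono
    fun n ω ⟨h1, h2⟩ i l => ?_
  rcases l with j | k
  · exact h1 j i
  · exact h2 k i

end PostulatedModels

end MRobust

theorem theorem7
    {Ω : Type*} [MeasurableSpace Ω] (P : Measure Ω) [IsProbabilityMeasure P]
    {X : Type*} [MeasurableSpace X] [StandardBorelSpace X] {Q : ℕ}
    -- the law `ν` of a unit and an i.i.d. sample from it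
    (ν : Measure (MRobust.Record X Q)) [IsProbabilityMeasure ν]
    (Z : ℕ → Ω → MRobust.Record X Q)
    (hZ_meas : ∀ i, Measurable (Z i)) (hZ_law : ∀ i, P.map (Z i) = ν) (hZ_indep : iIndepFun Z P)
    (hY : ∀ d, Integrable (MRobust.pot d) ν)
    -- the treatment level, with unconfoundedness and positivity
    (q : Fin Q) (h_unconf : MRobust.Unconfounded ν q)
    (h_pos : ∀ᵐ z ∂ν, 0 < MRobust.propensity ν q z)
    -- the propensity score models and the outcome regression models
    {J K : ℕ} {A : Fin J → Type*} {B : Fin K → Type*}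
    [∀ j, PseudoMetricSpace (A j)] [∀ k, PseudoMetricSpace (B k)]
    (ps : ∀ j, X → Fin Q → A j → ℝ) (om : ∀ k, X → Fin Q → B k → ℝ)
    (h_ps_meas : ∀ j d α, Measurable fun x => ps j x d α)
    (h_om_meas : ∀ k d β, Measurable fun x => om k x d β)
    -- the estimators of the parameters, and their limits in probability
    (αhat : ℕ → Ω → ∀ j, A j) (βhat : ℕ → Ω → ∀ k, B k)
    (αs : ∀ j, A j) (βs : ∀ k, B k)
    (h_α : ∀ j, TendstoInMeasure P (fun n ω => αhat n ω j) atTop (fun _ => αs j))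
    (h_β : ∀ k, TendstoInMeasure P (fun n ω => βhat n ω k) atTop (fun _ => βs k))
    -- the limits give the true functions whenever the model is correctly specified
    (h_ps_fit : ∀ j, (∃ α₀, MRobust.CorrectPSAt ν (ps j) α₀) →
      MRobust.CorrectPSAt ν (ps j) (αs j))
    (h_om_fit : ∀ k, (∃ β₀, MRobust.CorrectORAt ν (om k) β₀) →
      MRobust.CorrectORAt ν (om k) (βs k))
    -- regularity at the limits
    (h_ps_reg : ∀ j, MRobust.RegularAt ν (ps j) q (αs j))
    (h_om_reg : ∀ k, MRobust.RegularAt ν (om k) q (βs k))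
    (h_nondeg : MRobust.Nondegenerate ν (MRobust.modelVec ps om q αs βs)) :
    let hhat : ℕ → Ω → X → Fin J ⊕ Fin K → ℝ :=
      fun n ω => MRobust.modelVec ps om q (αhat n ω) (βhat n ω)
    let hlim : X → Fin J ⊕ Fin K → ℝ := MRobust.modelVec ps om q αs βs
    let zs : Ω → ℕ → MRobust.Record X Q := fun ω i => Z i ω
    let ρhat : ℕ → Ω → Fin J ⊕ Fin K → ℝ := fun n ω => MRobust.rhoMin (hhat n ω) q n (zs ω)
    let μhat : ℕ → Ω → ℝ := fun n ω => MRobust.muHat (hhat n ω) q n (zs ω)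
    -- the minimiser exists, is unique and solves the estimating equation
    MRobust.WPTO P (fun n ω => MRobust.WellPosed (hhat n ω) q n (zs ω)) ∧
    -- some propensity score model is correct
    ((∃ c > 0, ∀ᵐ z ∂ν, c ≤ MRobust.propensity ν q z) →
      ∀ j, (∃ α₀, MRobust.CorrectPSAt ν (ps j) α₀) →
        MRobust.WPTO P (fun n ω =>
          ∃ lam, MRobust.IsMultiplier (hhat n ω) q n (zs ω) (Sum.inl j) lam ∧
            (∀ lam', MRobust.IsMultiplier (hhat n ω) q n (zs ω) (Sum.inl j) lam' → lam' = lam) ∧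
            ρhat n ω = MRobust.rhoPi (hhat n ω) n (zs ω) (Sum.inl j) lam) ∧
        TendstoInMeasure P μhat atTop (fun _ => MRobust.apo ν q)) ∧
    -- the limit of the minimisers, and the case that some outcome regression model is correct
    (∀ ρs ∈ MRobust.limDomain ν hlim q,
      IsMinOn (MRobust.limObjective ν hlim q) (MRobust.limDomain ν hlim q) ρs →
        TendstoInMeasure P ρhat atTop (fun _ => ρs) ∧
        ∀ k, (∃ β₀, MRobust.CorrectORAt ν (om k) β₀) →
          TendstoInMeasure P μhat atTop (fun _ => MRobust.apo ν q)) := by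
  intro hhat hlim zs ρhat μhat
  have hZ : MRobust.IsIIDSample P ν Z := ⟨hZ_meas, hZ_law, hZ_indep⟩
  obtain ⟨C, hb⟩ := MRobust.exists_boundedModel_modelVec h_ps_meas h_om_meas h_ps_reg h_om_reg
  have hc : MRobust.UniformlyClose P Z hhat hlim :=
    hZ.uniformlyClose_modelVec h_ps_reg h_om_reg h_α h_β
  have hwp := hc.wpto_wellPosed hZ hb h_pos h_nondeg
  refine ⟨hwp, ?_, fun ρs hρs hmin => ?_⟩
  · rintro ⟨c, hc0, hcπ⟩ j hj
    have hps : (fun z : MRobust.Record X Q => hlim (MRobust.cov z) (Sum.inl j)) =ᵐ[ν]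
        MRobust.propensity ν q := h_ps_fit j hj q
    have hcps : ∀ᵐ z ∂ν, c ≤ hlim (MRobust.cov z) (Sum.inl j) := by
      filter_upwards [hcπ, hps] with z h1 h2
      rwa [h2]
    have hmean := hb.le_integral hcps
    obtain ⟨-, -, hdom, hmin⟩ := hb.isMinOn_single hc0 hcπ hps rfl
    refine ⟨?_, ?_⟩
    · refine (((hwp.and (hc.wpto_meanVec hZ hb (half_pos hc0))).and (hc (c / 2) (half_pos hc0))).and
        (hZ.wpto_of_ae hcps)).mono fun n ω ⟨⟨⟨h1, h2⟩, h3⟩, h4⟩ => ?_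
      refine h1.existsUnique_multiplier ?_ fun i _ => ?_
      · have h5 := (abs_le.1 (h2 (Sum.inl j))).1
        linarith
      · have h5 := (abs_le.1 (h3 i (Sum.inl j))).1
        have h6 := h4 i
        change 0 < hhat n ω (MRobust.cov (Z i ω)) (Sum.inl j)
        linarith
    · exact hc.tendsto_muHat hZ hb h_pos hY hdom
        (fun η hη => hc.tendsto_rhoMin hZ hb h_pos h_nondeg hdom hmin hη)
        (hb.integral_obsY_of_propensity hc0 hcπ hps h_unconf (hY q) rfl)
  · have hconv := fun (η : ℝ) (hη : 0 < η) =>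
      hc.tendsto_rhoMin hZ hb h_pos h_nondeg hρs hmin hη
    refine ⟨MRobust.tendstoInMeasure_const_iff_wpto.2 hconv, fun k hk => ?_⟩
    refine hc.tendsto_muHat hZ hb h_pos hY hρs hconv
      (hb.integral_obsY_of_outcomeReg (l := Sum.inr k) h_pos h_unconf hY hρs ?_
        (hc.integral_gLim_mul_eq_zero hZ hb h_pos h_nondeg hρs hconv _))
    filter_upwards [h_om_fit k hk] with z hz hq
    rw [← hz, hq]
    rfl
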